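/- Let $C$ be a CSS code on $n$ qubits with parameters $[[n,k,d]]$ ($d$ is the least weight of a Pauli operator that commutes with all stabilizers without being, up to phase, a stabilizer), let $\Pi_0$ be the projector onto its code space, and fix logical operators $\bar X_i=X^{\alpha_i}$, $\bar Z_i=Z^{\beta_i}$ ($1\le i\le k$), where $\bar X_i$ and $\bar Z_j$ anticommute exactly when $i=j$. Let $\bar P=\bar P_{\mu,\nu}=i^{|\mu\wedge\nu|}\,\bar X^{\mu}\bar Z^{\nu}$, $(\mu,\nu)\neq(0,0)$, be a nontrivial logical Pauli operator (with $\bar Y_i=i\bar X_i\bar Z_i$) that acts nontrivially on $Q\le d$ logical qubits. A *step* consists of physical Pauli rotations $e^{i\theta_m P_m}$, $1\le m\le M$, with $P_m\in\{I,X,Y,Z\}^{\otimes n}$ of pairwise disjoint supports (one layer), followed by the measurement of all stabilizer generators and a Pauli correction that depends only on the syndrome. A circuit is a sequence of steps; its depth is the number of steps. It *realizes* the ensemble $(p_o,\bar V_o)_o$ of probabilities and logical unitaries if, for every input state $\rho$ on the code space, the sequence $o$ of syndromes is obtained with probability $p_o$ and the state is then $\bar V_o\rho\bar V_o^\dagger$;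 neither $p_o$ nor $\bar V_o$ depends on $\rho$. A family of circuits with a real parameter $\theta$ is a *weak transversal $\bar P$ rotation gate* if every member realizes an ensemble of rotations $e^{i\phi_o\bar P}$, and for every $\phi\in\mathbb R$ there is a $\theta$ for which $e^{i\phi\bar P}$ is realized with nonzero probability. A *disjoint support partition* of a Pauli operator $L$ consists of an odd number $M$ of Pauli operators $P_m$ with pairwise disjoint supports such that $L=\prod_m P_m$ and $\Pi_0\prod_{m\in R}P_m\Pi_0=0$ for every nonempty $R\subsetneq\{1,\dots,M\}$. It is *pivoted* if there are a set $J$ of pivot qubits and nontrivial logical Pauli operators $L_j$ ($j\in J$), each the restriction of $L$ to a subset of its support, in reduced row echelon form (the support of $L_j$ contains $j$ and no other pivot) and with product $L$ up to phase, such that one block $P_{m_0}$ acts on all the pivots and on at most one further qubit, and every other block is a single-qubit Pauli operator. Then: 1. There are a Pauli operator $L$ that acts on the code space as $\pm\bar P$, a pivoted disjoint support partition $P_1,\dots,P_M$ of $L$, and a syndrome-dependent Pauli correction, such that the circuit of depth one with the rotations $\prod_m e^{i\theta P_m}$ is a weak transversal $\bar P$ rotation gate. For arbitrary, not necessarily equal,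 angles $\theta_m$, too, the circuit with the rotations $\prod_m e^{i\theta_mP_m}$ realizes an ensemble of rotations $e^{i\phi_o\bar P}$ that does not depend on the input state. 2. The $Y$ factors can also be handled by conjugation with $S$ and $S^\dagger$ gates. Let $Y=\{i:\mu_i=\nu_i=1\}$. There are a pivoted disjoint support partition of an operator that acts on the code space as $\pm\bar P_{\mu,\nu-\mu\wedge\nu}$ and, for each $i$, one of an operator that acts there as $\pm\bar Z_i$, with syndrome-dependent Pauli corrections, such that (a) for each $i$ the step with all angles $\pi/4$ on the partition for $\bar Z_i$ realizes the logical gate $\bar S_i$ with certainty, and with other corrections $\bar S_i^\dagger$ with certainty; (b) the circuit of the steps for $\bar S_i^\dagger$, $i\in Y$, then the step with all angles $\theta$ on the partition for $\bar P_{\mu,\nu-\mu\wedge\nu}$, then the steps for $\bar S_i$, $i\in Y$, in all $2|Y|+1$ steps, is a weak transversal $\bar P$ rotation gate. -/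

import Mathlib

open scoped Matrix ComplexOrder

noncomputable section

namespace WeakTransversal

/-! ### Pauli operators on `n` qubits -/

/-- Operators on `n` qubits, as matrices in the computational basis `(ℤ/2)^n`. -/
abbrev Op (n : ℕ) : Type := Matrix (Fin n → ZMod 2) (Fin n → ZMod 2) ℂ

/-- The operator `X^a`, sending `|x⟩` to `|x + a⟩`. -/
def xOp {n : ℕ} (a : Fin n → ZMod 2) : Op n :=
  Matrix.of fun y x => if y = x + a then 1 else 0

/-- The sign `(-1)^t` of a bit `t`. -/
def sgn (t : ZMod 2) : ℂ := (-1) ^ t.val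

/-- The operator `Z^b`, sending `|x⟩` to `(-1)^(b·x) |x⟩`. -/
def zOp {n : ℕ} (b : Fin n → ZMod 2) : Op n :=
  Matrix.diagonal fun x => sgn (b ⬝ᵥ x)

/-- An unsigned Pauli string: `X`-part and `Z`-part. At site `j` the pair of bits
`(0,0), (1,0), (0,1), (1,1)` means `I, X, Z, Y`. -/
abbrev PauliString (n : ℕ) : Type := (Fin n → ZMod 2) × (Fin n → ZMod 2)

/-- The Hermitian operator of a Pauli string (`Y = i X Z` on each site). -/
def pauliOp {n : ℕ} (p : PauliString n) : Op n :=
  Complex.I ^ (Finset.univ.filter fun j => p.1 j ≠ 0 ∧ p.2 j ≠ 0).card • (xOp p.1 * zOp p.2)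

/-- The sites on which a Pauli string is not the identity. -/
def supp {n : ℕ} (p : PauliString n) : Finset (Fin n) :=
  Finset.univ.filter fun j => p.1 j ≠ 0 ∨ p.2 j ≠ 0

/-- The Pauli string that agrees with `p` on `R` and is the identity elsewhere. -/
def restrict {n : ℕ} (p : PauliString n) (R : Finset (Fin n)) : PauliString n :=
  (fun j => if j ∈ R then p.1 j else 0, fun j => if j ∈ R then p.2 j else 0)

/-- The rotation `exp(i θ A)`. -/
def rot {n : ℕ} (θ : ℝ) (A : Op n) : Op n :=
  NormedSpace.exp ((Complex.I * (θ : ℂ)) • A)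

/-! ### CSS codes -/

/-- A CSS code on `n` qubits: the rows of `HX` (of `HZ`) are the `X`-type (the `Z`-type)
stabilizer generators, which commute. -/
structure CSSCode (n : ℕ) where
  rX : ℕ
  rZ : ℕ
  HX : Matrix (Fin rX) (Fin n) (ZMod 2)
  HZ : Matrix (Fin rZ) (Fin n) (ZMod 2)
  comm : HX * HZᵀ = 0

namespace CSSCode

variable {n : ℕ} (C : CSSCode n)

/-- A Pauli string that commutes with every stabilizer and is not itself (up to sign) a
stabilizer. -/
def IsNontrivialLogical (p : PauliString n) : Prop :=
  C.HZ *ᵥ p.1 = 0 ∧ C.HX *ᵥ p.2 = 0 ∧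
    ¬ (p.1 ∈ Submodule.span (ZMod 2) (Set.range C.HX.row) ∧
        p.2 ∈ Submodule.span (ZMod 2) (Set.range C.HZ.row))

/-- `C` is an `[[n, k, d]]` code: it encodes `k` qubits, and `d` is the least weight of a
nontrivial logical Pauli string. -/
def HasParameters (k d : ℕ) : Prop :=
  C.HX.rank + C.HZ.rank + k = n ∧
    IsLeast {w | ∃ p : PauliString n, C.IsNontrivialLogical p ∧ (supp p).card = w} d

/-- Outcomes of the measurement of all stabilizer generators. -/
abbrev Syndrome : Type := (Fin C.rX → ZMod 2) × (Fin C.rZ → ZMod 2)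

/-- The projector `∏ᵢ (1 + (-1)^(sᵢ) gᵢ) / 2` of the syndrome `s`. -/
def synProj (s : C.Syndrome) : Op n :=
  (List.ofFn fun i => (1 / 2 : ℂ) • (1 + sgn (s.1 i) • xOp (C.HX.row i))).prod *
    (List.ofFn fun i => (1 / 2 : ℂ) • (1 + sgn (s.2 i) • zOp (C.HZ.row i))).prod

/-- The projector onto the code space. -/
def codeProj : Op n := C.synProj 0

/-- Density operators on the code space. -/
def IsCodeState (ρ : Op n) : Prop :=
  ρ.PosSemidef ∧ ρ.trace = 1 ∧ C.codeProj * ρ * C.codeProj = ρ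

/-- A unitary that preserves the code space and its orthogonal complement. -/
def IsLogicalUnitary (V : Op n) : Prop :=
  V ∈ Matrix.unitaryGroup (Fin n → ZMod 2) ℂ ∧ Commute V C.codeProj

/-- A choice of the `k` logical qubits: logical operators `X^(α i)` and `Z^(β i)`, with
`X^(α i)` and `Z^(β j)` anticommuting exactly for `i = j`. -/
structure LogicalBasis (k : ℕ) where
  α : Fin k → Fin n → ZMod 2
  β : Fin k → Fin n → ZMod 2
  α_logical : ∀ i, C.HZ *ᵥ α i = 0
  β_logical : ∀ i, C.HX *ᵥ β i = 0
  pairing : ∀ i j, α i ⬝ᵥ β j = if i = j then 1 else 0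

/-- The logical Pauli operator with logical `X`-part `μ` and logical `Z`-part `ν`: the product
of the logical `X`, `Z` or `Y = i X Z` of the logical qubits. -/
def LogicalBasis.logicalPauli {C : CSSCode n} {k : ℕ} (B : C.LogicalBasis k)
    (μ ν : Fin k → ZMod 2) : Op n :=
  Complex.I ^ (Finset.univ.filter fun i => μ i ≠ 0 ∧ ν i ≠ 0).card •
    (xOp (∑ i, μ i • B.α i) * zOp (∑ i, ν i • B.β i))

/-- The logical `Z` of the `i`-th logical qubit. -/
def LogicalBasis.logicalZ {C : CSSCode n} {k : ℕ} (B : C.LogicalBasis k) (i : Fin k) : Op n :=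
  B.logicalPauli 0 (Pi.single i 1)

/-- The logical `S = diag(1, i)` gate of the `i`-th logical qubit. -/
def LogicalBasis.logicalS {C : CSSCode n} {k : ℕ} (B : C.LogicalBasis k) (i : Fin k) : Op n :=
  (1 / 2 : ℂ) • (1 + B.logicalZ i) + (Complex.I / 2) • (1 - B.logicalZ i)

/-- The Pauli string `L` acts on the code space as the operator `A`, up to sign. -/
def Represents (L : PauliString n) (A : Op n) : Prop :=
  pauliOp L * C.codeProj = A * C.codeProj ∨ pauliOp L * C.codeProj = -(A * C.codeProj)

/-! ### Disjoint support partitions -/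

/-- The Pauli strings `P m` have pairwise disjoint supports, their product is `L`, their number
is odd, and the product over any nonempty proper subset moves the code space to an orthogonal
subspace. -/
def IsDisjointSupportPartition (L : PauliString n) {M : ℕ} (P : Fin M → PauliString n) : Prop :=
  (Pairwise fun m m' => Disjoint (supp (P m)) (supp (P m'))) ∧
  (List.ofFn fun m => pauliOp (P m)).prod = pauliOp L ∧
  Odd M ∧
  ∀ R : Finset (Fin M), R.Nonempty → R ≠ Finset.univ →
    C.codeProj * (List.ofFn fun m => if m ∈ R then pauliOp (P m) else 1).prod * C.codeProj = 0

/-- The partition comes from pivoting. The family `row j`, for `j` in the set `J` of pivots, is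
the reduced row echelon form `(I | *)`, up to the order of the columns: it lists nontrivial
logical operators supported inside `L`, the `j`-th one containing `j` and no other pivot, and
their product is `L`. One block consists of all pivots and of at most one further qubit
(which adjusts the parity of the number of blocks), and every other block is a single qubit. -/
def IsPivoted (L : PauliString n) {M : ℕ} (P : Fin M → PauliString n) : Prop :=
  ∃ (J : Finset (Fin n)) (row : Fin n → Finset (Fin n)) (m₀ : Fin M),
    (∀ j ∈ J, row j ⊆ supp L ∧ row j ∩ J = {j} ∧ C.IsNontrivialLogical (restrict L (row j))) ∧
    (∀ q ∈ supp L, Odd (J.filter fun j => q ∈ row j).card) ∧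
    J ⊆ supp (P m₀) ∧ (supp (P m₀) \ J).card ≤ 1 ∧
    ∀ m, m ≠ m₀ → (supp (P m)).card = 1

/-! ### Circuits with syndrome measurement and correction -/

/-- One step of a circuit: the physical Pauli rotations `exp(i (angle m) (P m))`, then the
measurement of all stabilizer generators, then a Pauli correction determined by the syndrome. -/
structure Step where
  M : ℕ
  P : Fin M → PauliString n
  angle : Fin M → ℝ
  corr : C.Syndrome → PauliString n

/-- The rotations of a step act on pairwise disjoint sets of qubits, so that they form a single
layer (depth one). -/
def Step.IsLayer {C : CSSCode n} (st : C.Step) : Prop :=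
  Pairwise fun m m' => Disjoint (supp (st.P m)) (supp (st.P m'))

/-- The Kraus operator of a step for the syndrome `s`. -/
def Step.kraus {C : CSSCode n} (st : C.Step) (s : C.Syndrome) : Op n :=
  pauliOp (st.corr s) * C.synProj s *
    (List.ofFn fun m => rot (st.angle m) (pauliOp (st.P m))).prod

/-- A circuit: its steps in the order of time. -/
abbrev Circuit : Type := List C.Step

/-- The Kraus operator of a circuit for a sequence of syndromes, one for each step. -/
def circuitKraus : (c : C.Circuit) → (Fin c.length → C.Syndrome) → Op n
  | [], _ => 1
  | st :: rest, o => circuitKraus rest (fun i => o i.succ) * st.kraus (o 0)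

/-- On the code space the circuit realizes the ensemble `(p o, V o)` of logical unitaries: for
every input state the outcome `o` has the probability `p o` and leaves the state transformed by
`V o`. Neither `p` nor `V` depends on the input. -/
def Realizes (c : C.Circuit) (p : (Fin c.length → C.Syndrome) → ℝ)
    (V : (Fin c.length → C.Syndrome) → Op n) : Prop :=
  (∀ o, 0 ≤ p o) ∧ ∑ o, p o = 1 ∧ (∀ o, C.IsLogicalUnitary (V o)) ∧
    ∀ ρ, C.IsCodeState ρ → ∀ o,
      C.circuitKraus c o * ρ * (C.circuitKraus c o)ᴴ = (p o : ℂ) • (V o * ρ * (V o)ᴴ)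

/-- The circuit is weakly transversal of depth at most `D` (counted in steps), and all the logical
unitaries that it realizes are rotations about `A`. -/
def IsWeakTransversal (A : Op n) (D : ℕ) (c : C.Circuit) : Prop :=
  c.length ≤ D ∧ (∀ st ∈ c, st.IsLayer) ∧
    ∃ (p : (Fin c.length → C.Syndrome) → ℝ) (φ : (Fin c.length → C.Syndrome) → ℝ),
      C.Realizes c p (fun o => rot (φ o) A)

/-- The family `c` of circuits, with parameter `θ`, is a weak transversal rotation gate about `A`
of depth at most `D`: each member is weakly transversal, and every logical angle is reached with
nonzero probability for a suitable parameter. -/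
def IsWeakTransversalRotation (A : Op n) (D : ℕ) (c : ℝ → C.Circuit) : Prop :=
  (∀ θ, C.IsWeakTransversal A D (c θ)) ∧
    ∀ φ : ℝ, ∃ θ : ℝ, ∃ (p : (Fin (c θ).length → C.Syndrome) → ℝ)
      (ψ : (Fin (c θ).length → C.Syndrome) → ℝ),
      C.Realizes (c θ) p (fun o => rot (ψ o) A) ∧ ∃ o, 0 < p o ∧ ψ o = φ

end CSSCode

/-- The number of logical qubits on which the logical Pauli `(μ, ν)` acts nontrivially. -/
def bodyCount {k : ℕ} (μ ν : Fin k → ZMod 2) : ℕ :=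
  (Finset.univ.filter fun i => μ i ≠ 0 ∨ ν i ≠ 0).card

/-- The logical qubits on which the logical Pauli `(μ, ν)` acts as `Y`. -/
def ySites {k : ℕ} (μ ν : Fin k → ZMod 2) : List (Fin k) :=
  (List.finRange k).filter fun i => decide (μ i ≠ 0 ∧ ν i ≠ 0)

end WeakTransversal

end

open WeakTransversal

/-! Each of the three partitions comes from one construction. Among the Pauli strings that act on
the code space as `± P̄` take one, `L`, of least weight. No nonempty part of it is a stabilizer,
because that part could be removed (`exists_isReduced`). So the nonempty subsets of `supp L` on
which the restriction of `L` commutes with all stabilizers all give nontrivial logical operators.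
These subsets form a subspace over `ℤ/2` (`logicalParts`), and the rows of its reduced echelon
form are the operators `L_j` of the pivots. The block of all pivots (with one more qubit if parity
demands it) and the single remaining qubits form the partition: a union of blocks contains all
pivots or none, and an element of the subspace is determined by its pivots, so only the empty and
the full union commute with all stabilizers (`IsReduced.exists_partition`).

Expanding `∏ₘ (cos Φₘ + i sin Φₘ Pₘ)` gives a sum over sets `R` of blocks. The syndrome of
`∏_{m ∈ R} Pₘ` determines `R` up to complement, so a measured syndrome leaves two terms, which after the
correction by one of them act as `a + b L` (`IsBlockPartition.kraus_mul_codeProj`). The number of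
blocks is odd, so `a` and `b` have the relative phase `± i`, and `a + b L` is a multiple of a
rotation about `L` (`exists_rot_of_odd`), whatever the input state is. For equal angles the
trivial syndrome leaves `cosᴹ θ + (i sin θ)ᴹ L`, which reaches every direction, since odd roots of
reals exist (`exists_angle_of_odd`). At `θ = π/4` all coefficients have the same modulus, so each
syndrome leaves a rotation by `± π/4`; exchanging the two complementary corrections changes the
sign, and this makes the gates `S̄` and `S̄†` deterministic (`exists_decoder_quarter`).

Finally `S̄ᵢ` commutes with logical `Z` operators and satisfies `S̄ᵢ X̄ᵢ S̄ᵢ† = i X̄ᵢ Z̄ᵢ`, so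
conjugation turns the rotation about the operator without `Y` factors into the one about `P̄`
(`prod_logicalS_conj_rot`). -/

namespace WeakTransversal

/-! ### Algebra of Pauli operators -/

section PauliAlgebra

variable {n : ℕ}

lemma sgn_add (s t : ZMod 2) : sgn (s + t) = sgn s * sgn t := by
  rw [sgn, sgn, sgn, ZMod.val_add, ← neg_one_pow_eq_pow_mod_two, pow_add]

@[simp] lemma sgn_zero : sgn 0 = 1 := by simp [sgn]

lemma sgn_one : sgn 1 = -1 := by simp [sgn, ZMod.val_one]

lemma bits_add_self (a : Fin n → ZMod 2) : a + a = 0 := by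
  ext j; exact CharTwo.add_self_eq_zero _

lemma sgn_mul_self (s : ZMod 2) : sgn s * sgn s = 1 := by
  rw [← sgn_add, CharTwo.add_self_eq_zero, sgn_zero]

lemma sgn_natCast (c : ℕ) : sgn (c : ZMod 2) = (-1) ^ c := by
  induction c with
  | zero => simp
  | succ c ih => rw [Nat.cast_succ, sgn_add, ih, sgn_one, pow_succ]

lemma star_sgn (s : ZMod 2) : star (sgn s) = sgn s := by simp [sgn]

lemma dotProduct_eq_card {m : ℕ} (a b : Fin m → ZMod 2) :
    a ⬝ᵥ b = ((Finset.univ.filter fun j => a j ≠ 0 ∧ b j ≠ 0).card : ZMod 2) := by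
  rw [Finset.card_filter, dotProduct, Nat.cast_sum]
  refine Finset.sum_congr rfl fun j _ => ?_
  generalize a j = s; generalize b j = t
  revert s t; decide

@[simp] lemma xOp_zero : xOp (0 : Fin n → ZMod 2) = 1 := by
  ext y x; simp [xOp, Matrix.one_apply]

@[simp] lemma zOp_zero : zOp (0 : Fin n → ZMod 2) = 1 := by
  simp [zOp]

lemma xOp_mul_xOp (a b : Fin n → ZMod 2) : xOp a * xOp b = xOp (a + b) := by
  ext y x
  simp only [xOp, Matrix.mul_apply, Matrix.of_apply, mul_ite, mul_one, mul_zero]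
  simp [add_assoc, add_comm b a]

lemma zOp_mul_zOp (a b : Fin n → ZMod 2) : zOp a * zOp b = zOp (a + b) := by
  simp [zOp, Matrix.diagonal_mul_diagonal, add_dotProduct, sgn_add]

lemma zOp_mul_xOp (b a : Fin n → ZMod 2) :
    zOp b * xOp a = sgn (b ⬝ᵥ a) • (xOp a * zOp b) := by
  ext y x
  simp only [xOp, zOp, Matrix.diagonal_mul, Matrix.smul_apply, Matrix.mul_diagonal,
    Matrix.of_apply, smul_eq_mul]
  split_ifs with h
  · rw [h, dotProduct_add, sgn_add]; ring
  · simp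

lemma conjTranspose_xOp (a : Fin n → ZMod 2) : (xOp a)ᴴ = xOp a := by
  ext y x
  simp only [xOp, Matrix.conjTranspose_apply, Matrix.of_apply]
  have : (x = y + a) ↔ (y = x + a) := by
    constructor <;> rintro rfl <;> rw [add_assoc, bits_add_self, add_zero]
  simp only [this]
  split_ifs <;> simp

lemma conjTranspose_zOp (b : Fin n → ZMod 2) : (zOp b)ᴴ = zOp b := by
  simp only [zOp, Matrix.diagonal_conjTranspose]
  congr 1; ext x; simp [star_sgn]

/-- `i ^ c` depends on the parity of `c` only up to sign. -/
lemma I_pow_eq_or_of_cast_eq {c c' : ℕ} (h : (c : ZMod 2) = c') :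
    Complex.I ^ c = Complex.I ^ c' ∨ Complex.I ^ c = -Complex.I ^ c' := by
  rw [ZMod.natCast_eq_natCast_iff'] at h
  rw [← Nat.mod_add_div c 2, ← Nat.mod_add_div c' 2, h, pow_add, pow_add, pow_mul, pow_mul,
    Complex.I_sq]
  rcases neg_one_pow_eq_or ℂ (c / 2) with h1 | h1 <;>
  rcases neg_one_pow_eq_or ℂ (c' / 2) with h2 | h2 <;> simp [h1, h2]

lemma hermitian_I_pow_smul {c : ℕ} {a b : Fin n → ZMod 2} (h : a ⬝ᵥ b = c) :
    (Complex.I ^ c • (xOp a * zOp b))ᴴ = Complex.I ^ c • (xOp a * zOp b) := by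
  rw [Matrix.conjTranspose_smul, Matrix.conjTranspose_mul, conjTranspose_xOp, conjTranspose_zOp,
    zOp_mul_xOp, smul_smul, dotProduct_comm, h, sgn_natCast]
  congr 1
  rw [star_pow, ← mul_pow]
  simp

lemma I_pow_smul_mul_self {c : ℕ} {a b : Fin n → ZMod 2} (h : a ⬝ᵥ b = c) :
    (Complex.I ^ c • (xOp a * zOp b)) * (Complex.I ^ c • (xOp a * zOp b)) = 1 := by
  have : xOp a * zOp b * (xOp a * zOp b) = sgn (b ⬝ᵥ a) • (1 : Op n) := by
    rw [mul_assoc, ← mul_assoc (zOp b), zOp_mul_xOp, smul_mul_assoc, mul_smul_comm, mul_assoc,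
      zOp_mul_zOp, bits_add_self, zOp_zero, mul_one, xOp_mul_xOp,
      bits_add_self, xOp_zero]
  rw [smul_mul_smul_comm, this, smul_smul, dotProduct_comm, h, sgn_natCast, ← mul_pow, ← mul_pow]
  simp

lemma pauliOp_mul_self (p : PauliString n) : pauliOp p * pauliOp p = 1 :=
  I_pow_smul_mul_self (dotProduct_eq_card _ _)

@[simp] lemma pauliOp_zero : pauliOp (0 : PauliString n) = 1 := by
  simp [pauliOp]

lemma restrict_empty (L : PauliString n) : restrict L ∅ = 0 := by
  ext <;> simp [restrict]

lemma restrict_supp (L : PauliString n) : restrict L (supp L) = L := by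
  ext j <;> simp only [restrict, supp, Finset.mem_filter, Finset.mem_univ, true_and] <;>
    split_ifs with h <;> simp_all

lemma supp_restrict (L : PauliString n) (S : Finset (Fin n)) :
    supp (restrict L S) = supp L ∩ S := by
  ext j
  by_cases h : j ∈ S <;> simp [supp, restrict, h]

/-- Restrictions of a Pauli operator to disjoint sets of sites multiply without a phase. -/
lemma pauliOp_restrict_mul (L : PauliString n) {S T : Finset (Fin n)} (h : Disjoint S T) :
    pauliOp (restrict L S) * pauliOp (restrict L T) = pauliOp (restrict L (S ∪ T)) := by
  have hd : ∀ j, j ∈ S → j ∉ T := fun j hS hT => Finset.disjoint_left.1 h hS hT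
  have h1 : (restrict L S).1 + (restrict L T).1 = (restrict L (S ∪ T)).1 := by
    ext j; have := hd j
    by_cases hS : j ∈ S <;> by_cases hT : j ∈ T <;> simp_all [restrict]
  have h2 : (restrict L S).2 + (restrict L T).2 = (restrict L (S ∪ T)).2 := by
    ext j; have := hd j
    by_cases hS : j ∈ S <;> by_cases hT : j ∈ T <;> simp_all [restrict]
  have h3 : (restrict L S).2 ⬝ᵥ (restrict L T).1 = 0 := by
    refine Finset.sum_eq_zero fun j _ => ?_
    have := hd j
    by_cases hS : j ∈ S <;> by_cases hT : j ∈ T <;> simp_all [restrict]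
  have h4 : (Finset.univ.filter fun j => (restrict L (S ∪ T)).1 j ≠ 0 ∧
        (restrict L (S ∪ T)).2 j ≠ 0) =
      (Finset.univ.filter fun j => (restrict L S).1 j ≠ 0 ∧ (restrict L S).2 j ≠ 0) ∪
        (Finset.univ.filter fun j => (restrict L T).1 j ≠ 0 ∧ (restrict L T).2 j ≠ 0) := by
    ext j; have := hd j
    by_cases hS : j ∈ S <;> by_cases hT : j ∈ T <;> simp_all [restrict]
  have h5 : Disjoint
      (Finset.univ.filter fun j => (restrict L S).1 j ≠ 0 ∧ (restrict L S).2 j ≠ 0)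
      (Finset.univ.filter fun j => (restrict L T).1 j ≠ 0 ∧ (restrict L T).2 j ≠ 0) := by
    rw [Finset.disjoint_left]
    intro j; have := hd j
    by_cases hS : j ∈ S <;> by_cases hT : j ∈ T <;> simp_all [restrict]
  rw [pauliOp, pauliOp, pauliOp, h4, Finset.card_union_of_disjoint h5, pow_add,
    smul_mul_smul_comm, mul_assoc, ← mul_assoc (zOp _), zOp_mul_xOp, h3, sgn_zero, one_smul,
    mul_assoc, zOp_mul_zOp, ← mul_assoc, xOp_mul_xOp, h1, h2]

/-- The rotation about an involution. -/
lemma rot_eq {A : Op n} (hA : A * A = 1) (θ : ℝ) :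
    rot θ A = (Real.cos θ : ℂ) • 1 + (Complex.I * Real.sin θ) • A := by
  set z : ℂ := Complex.I * θ with hz
  have hpow : ∀ m : ℕ, A ^ m = (1 / 2 : ℂ) • (1 + A) + ((-1) ^ m * (1 / 2) : ℂ) • (1 - A) := by
    intro m
    induction m with
    | zero => rw [pow_zero]; module
    | succ m ih =>
      rw [pow_succ, ih, add_mul, smul_mul_assoc, smul_mul_assoc, add_mul, sub_mul, hA, one_mul]
      module
  have hexp : ∀ w : ℂ, HasSum (fun m : ℕ => ((m.factorial : ℂ)⁻¹) * w ^ m) (Complex.exp w) := by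
    intro w
    have := NormedSpace.exp_series_hasSum_exp' (𝕂 := ℂ) w
    rw [← Complex.exp_eq_exp_ℂ] at this
    simpa using this
  have hsum := ((hexp z).smul_const ((1 / 2 : ℂ) • (1 + A))).add
    ((hexp (-z)).smul_const ((1 / 2 : ℂ) • (1 - A)))
  have : rot θ A = Complex.exp z • ((1 / 2 : ℂ) • (1 + A)) +
      Complex.exp (-z) • ((1 / 2 : ℂ) • (1 - A)) := by
    rw [← hsum.tsum_eq, rot, NormedSpace.exp_eq_tsum ℂ]
    refine tsum_congr fun m => ?_
    rw [smul_pow, hpow, neg_pow z]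
    module
  rw [this, hz, mul_comm Complex.I, ← neg_mul, Complex.exp_mul_I, Complex.exp_mul_I,
    Complex.cos_neg, Complex.sin_neg, Complex.ofReal_cos, Complex.ofReal_sin]
  module

end PauliAlgebra

/-! ### Syndromes and the syndrome projectors -/

section ListProducts

variable {ι 𝕜 R : Type*} [CommRing 𝕜] [Ring R] [Algebra 𝕜 R]

lemma list_prod_mul_of_semiconj {f g : ι → R} {a : R} (l : List ι)
    (h : ∀ i ∈ l, f i * a = a * g i) : (l.map f).prod * a = a * (l.map g).prod := by
  induction l with
  | nil => simp
  | cons i l ih =>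
    rw [List.map_cons, List.map_cons, List.prod_cons, List.prod_cons, mul_assoc,
      ih fun j hj => h j (List.mem_cons_of_mem _ hj), ← mul_assoc, h i List.mem_cons_self,
      mul_assoc]

lemma list_prod_mul_of_eigen {f : ι → R} {c : ι → 𝕜} {a : R} (l : List ι)
    (h : ∀ i ∈ l, f i * a = c i • a) : (l.map f).prod * a = (l.map c).prod • a := by
  induction l with
  | nil => simp
  | cons i l ih =>
    rw [List.map_cons, List.map_cons, List.prod_cons, List.prod_cons, mul_assoc,
      ih fun j hj => h j (List.mem_cons_of_mem _ hj), mul_smul_comm, h i List.mem_cons_self,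
      smul_smul, mul_comm]

lemma mul_list_prod_of_eigen {f : ι → R} {c : 𝕜} {a : R} (l : List ι)
    (hc : ∀ j ∈ l, Commute a (f j)) {i : ι} (hi : i ∈ l) (h : a * f i = c • f i) :
    a * (l.map f).prod = c • (l.map f).prod := by
  induction l with
  | nil => simp at hi
  | cons j l ih =>
    rw [List.map_cons, List.prod_cons, ← mul_assoc]
    rcases List.mem_cons.1 hi with rfl | hi
    · rw [h, smul_mul_assoc]
    · rw [(hc j List.mem_cons_self).eq, mul_assoc,
        ih (fun k hk => hc k (List.mem_cons_of_mem _ hk)) hi, mul_smul_comm]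

end ListProducts

namespace CSSCode

variable {n : ℕ} (C : CSSCode n)

/-- The syndrome of a Pauli string: which stabilizer generators it anticommutes with. -/
def syndromeOf (p : PauliString n) : C.Syndrome := (C.HX *ᵥ p.2, C.HZ *ᵥ p.1)

@[simp] lemma syndromeOf_zero : C.syndromeOf 0 = 0 := by
  simp [syndromeOf]

lemma xOp_mul_pauliOp (a : Fin n → ZMod 2) (p : PauliString n) :
    xOp a * pauliOp p = sgn (a ⬝ᵥ p.2) • (pauliOp p * xOp a) := by
  rw [pauliOp, mul_smul_comm, smul_mul_assoc, mul_assoc, zOp_mul_xOp, ← mul_assoc, xOp_mul_xOp,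
    mul_smul_comm, ← mul_assoc, xOp_mul_xOp, smul_comm (sgn _), smul_smul (sgn _),
    dotProduct_comm a, sgn_mul_self, one_smul, add_comm]

lemma zOp_mul_pauliOp (b : Fin n → ZMod 2) (p : PauliString n) :
    zOp b * pauliOp p = sgn (b ⬝ᵥ p.1) • (pauliOp p * zOp b) := by
  rw [pauliOp, mul_smul_comm, smul_mul_assoc, ← mul_assoc, zOp_mul_xOp, smul_mul_assoc, mul_assoc,
    zOp_mul_zOp, mul_assoc, zOp_mul_zOp, smul_comm (sgn _), add_comm]

/-- The eigenprojector of a generator `g` for the outcome `t`. -/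
noncomputable def genProj (g : Op n) (t : ZMod 2) : Op n := (1 / 2 : ℂ) • (1 + sgn t • g)

lemma synProj_eq (s : C.Syndrome) : C.synProj s =
    ((List.finRange C.rX).map fun i => genProj (xOp (C.HX.row i)) (s.1 i)).prod *
      ((List.finRange C.rZ).map fun i => genProj (zOp (C.HZ.row i)) (s.2 i)).prod := by
  rw [synProj, List.ofFn_eq_map, List.ofFn_eq_map]; rfl

lemma genProj_mul_of_sign {g P : Op n} {u t : ZMod 2} (h : g * P = sgn u • (P * g)) :
    genProj g t * P = P * genProj g (t + u) := by
  rw [genProj, genProj, smul_mul_assoc, mul_smul_comm, add_mul, mul_add, smul_mul_assoc,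
    mul_smul_comm, h, smul_smul, sgn_add, one_mul, mul_one]

/-- A Pauli operator shifts the syndrome of a state by its own syndrome. -/
lemma synProj_mul_pauliOp (s : C.Syndrome) (p : PauliString n) :
    C.synProj s * pauliOp p = pauliOp p * C.synProj (s + C.syndromeOf p) := by
  rw [synProj_eq, synProj_eq, mul_assoc,
    list_prod_mul_of_semiconj (g := fun i =>
      genProj (zOp (C.HZ.row i)) ((s + C.syndromeOf p).2 i)), ← mul_assoc,
    list_prod_mul_of_semiconj (g := fun i =>
      genProj (xOp (C.HX.row i)) ((s + C.syndromeOf p).1 i)), mul_assoc]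
  · exact fun i _ => genProj_mul_of_sign (xOp_mul_pauliOp _ _)
  · exact fun i _ => genProj_mul_of_sign (zOp_mul_pauliOp _ _)

lemma mul_genProj_self {g : Op n} (hg : g * g = 1) (t : ZMod 2) :
    g * genProj g t = sgn t • genProj g t := by
  rw [genProj, mul_smul_comm, mul_add, mul_smul_comm, hg, mul_one, smul_comm (sgn t),
    smul_add (sgn t), smul_smul (sgn t) (sgn t), sgn_mul_self, one_smul, add_comm]

lemma genProj_mul_of_eigen {g P : Op n} {t s : ZMod 2} (h : g * P = sgn s • P) :
    genProj g t * P = (if t = s then 1 else 0 : ℂ) • P := by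
  rw [genProj, smul_mul_assoc, add_mul, smul_mul_assoc, h, smul_smul, one_mul, ← sgn_add]
  split_ifs with hts
  · rw [hts, CharTwo.add_self_eq_zero, sgn_zero]; module
  · have : t + s = 1 := by clear h; revert t s; decide
    rw [this, sgn_one]; module

lemma commute_genProj {g h : Op n} (hc : Commute g h) (t : ZMod 2) : Commute g (genProj h t) :=
  (((Commute.one_right g).add_right (hc.smul_right _)).smul_right _)

lemma xOp_mul_self (a : Fin n → ZMod 2) : xOp a * xOp a = 1 := by
  rw [xOp_mul_xOp, bits_add_self, xOp_zero]

lemma zOp_mul_self (a : Fin n → ZMod 2) : zOp a * zOp a = 1 := by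
  rw [zOp_mul_zOp, bits_add_self, zOp_zero]

lemma commute_zOp_xOp {a b : Fin n → ZMod 2} (h : b ⬝ᵥ a = 0) : Commute (zOp b) (xOp a) := by
  rw [Commute, SemiconjBy, zOp_mul_xOp, h, sgn_zero, one_smul]

lemma row_dotProduct (i : Fin C.rX) (j : Fin C.rZ) : C.HZ.row j ⬝ᵥ C.HX.row i = 0 := by
  have := congrFun (congrFun C.comm i) j
  rw [dotProduct_comm]
  simpa [Matrix.mul_apply, dotProduct] using this

lemma xGen_mul_synProj (s : C.Syndrome) (i : Fin C.rX) :
    xOp (C.HX.row i) * C.synProj s = sgn (s.1 i) • C.synProj s := by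
  rw [synProj_eq, ← mul_assoc, mul_list_prod_of_eigen (c := sgn (s.1 i)) _ _
    (List.mem_finRange i), smul_mul_assoc]
  · exact mul_genProj_self (xOp_mul_self _) _
  · refine fun j _ => commute_genProj ?_ _
    rw [Commute, SemiconjBy, xOp_mul_xOp, xOp_mul_xOp, add_comm]

lemma zGen_mul_synProj (s : C.Syndrome) (i : Fin C.rZ) :
    zOp (C.HZ.row i) * C.synProj s = sgn (s.2 i) • C.synProj s := by
  have hc : Commute (zOp (C.HZ.row i))
      ((List.finRange C.rX).map fun i => genProj (xOp (C.HX.row i)) (s.1 i)).prod := by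
    refine Commute.list_prod_right _ _ fun x hx => ?_
    obtain ⟨j, -, rfl⟩ := List.mem_map.1 hx
    exact commute_genProj (commute_zOp_xOp (C.row_dotProduct j i)) _
  rw [synProj_eq, ← mul_assoc, hc.eq, mul_assoc, mul_list_prod_of_eigen (c := sgn (s.2 i)) _ _
    (List.mem_finRange i), mul_smul_comm]
  · exact mul_genProj_self (zOp_mul_self _) _
  · refine fun j _ => commute_genProj ?_ _
    rw [Commute, SemiconjBy, zOp_mul_zOp, zOp_mul_zOp, add_comm]

/-- The syndrome projectors are idempotent and mutually orthogonal. -/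
lemma synProj_mul_synProj (t s : C.Syndrome) :
    C.synProj t * C.synProj s = if t = s then C.synProj s else 0 := by
  rw [C.synProj_eq t, mul_assoc,
    list_prod_mul_of_eigen (c := fun i => (if t.2 i = s.2 i then 1 else 0 : ℂ)),
    mul_smul_comm,
    list_prod_mul_of_eigen (c := fun i => (if t.1 i = s.1 i then 1 else 0 : ℂ)), smul_smul]
  · split_ifs with h
    · rw [h]; simp
    · suffices h0 : (List.map (fun i => if t.2 i = s.2 i then 1 else 0 : _ → ℂ)
          (List.finRange C.rZ)).prod * (List.map (fun i => if t.1 i = s.1 i then 1 else 0 : _ → ℂ)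
          (List.finRange C.rX)).prod = 0 by rw [h0, zero_smul]
      by_contra hne
      refine h (Prod.ext (funext fun i => ?_) (funext fun i => ?_))
      · by_contra hi
        exact hne (mul_eq_zero_of_right _ (List.prod_eq_zero
          (List.mem_map.2 ⟨i, List.mem_finRange i, by simp [hi]⟩)))
      · by_contra hi
        exact hne (mul_eq_zero_of_left (List.prod_eq_zero
          (List.mem_map.2 ⟨i, List.mem_finRange i, by simp [hi]⟩)) _)
  · exact fun i _ => genProj_mul_of_eigen (C.xGen_mul_synProj s i)
  · exact fun i _ => genProj_mul_of_eigen (C.zGen_mul_synProj s i)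

lemma conjTranspose_genProj {g : Op n} (hg : gᴴ = g) (t : ZMod 2) :
    (genProj g t)ᴴ = genProj g t := by
  rw [genProj, Matrix.conjTranspose_smul, Matrix.conjTranspose_add, Matrix.conjTranspose_smul, hg,
    star_sgn, Matrix.conjTranspose_one]
  norm_num

/-- Each factor of `Π₀` is Hermitian and fixes `Π₀`, so `Π₀ᴴ Π₀ = Π₀`, and the left-hand side is
Hermitian. -/
lemma conjTranspose_codeProj : C.codeProjᴴ = C.codeProj := by
  have h : C.codeProjᴴ * C.codeProj = C.codeProj := by
    conv_lhs => enter [1, 1]; rw [codeProj, synProj_eq]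
    rw [Matrix.conjTranspose_mul, Matrix.conjTranspose_list_prod, Matrix.conjTranspose_list_prod,
      List.map_map, List.map_map, ← List.map_reverse, ← List.map_reverse, mul_assoc,
      list_prod_mul_of_eigen (a := C.codeProj) (c := fun _ => (1 : ℂ)), mul_smul_comm,
      list_prod_mul_of_eigen (a := C.codeProj) (c := fun _ => (1 : ℂ))]
    · simp
    · intro i _
      rw [Function.comp, conjTranspose_genProj (conjTranspose_zOp _), codeProj,
        genProj_mul_of_eigen (C.zGen_mul_synProj 0 i), if_pos rfl]
    · intro i _
      rw [Function.comp, conjTranspose_genProj (conjTranspose_xOp _), codeProj,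
        genProj_mul_of_eigen (C.xGen_mul_synProj 0 i), if_pos rfl]
  calc C.codeProjᴴ = (C.codeProjᴴ * C.codeProj)ᴴ := by rw [h]
    _ = C.codeProjᴴ * C.codeProj := by
      rw [Matrix.conjTranspose_mul, Matrix.conjTranspose_conjTranspose]
    _ = C.codeProj := h

lemma synProj_mul_pauliOp_mul_codeProj (s : C.Syndrome) (p : PauliString n) :
    C.synProj s * (pauliOp p * C.codeProj) =
      if C.syndromeOf p = s then pauliOp p * C.codeProj else 0 := by
  have h : s + C.syndromeOf p = 0 ↔ C.syndromeOf p = s := by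
    have h2 : s + s = 0 := Prod.ext (bits_add_self _) (bits_add_self _)
    constructor
    · intro h
      rw [← zero_add (C.syndromeOf p), ← h2, add_assoc, h, add_zero]
    · rintro rfl; exact h2
  rw [← mul_assoc, synProj_mul_pauliOp, mul_assoc, codeProj, synProj_mul_synProj]
  simp only [h]
  split_ifs <;> simp

lemma commute_pauliOp_codeProj {p : PauliString n} (h : C.syndromeOf p = 0) :
    Commute (pauliOp p) C.codeProj := by
  rw [Commute, SemiconjBy, codeProj, synProj_mul_pauliOp, h, add_zero]

lemma xOp_mul_codeProj_of_mem_span {a : Fin n → ZMod 2}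
    (h : a ∈ Submodule.span (ZMod 2) (Set.range C.HX.row)) :
    xOp a * C.codeProj = C.codeProj := by
  induction h using Submodule.span_induction with
  | mem a ha =>
    obtain ⟨i, rfl⟩ := ha
    rw [codeProj, xGen_mul_synProj]; simp
  | zero => simp
  | add a b _ _ iha ihb => rw [← xOp_mul_xOp, mul_assoc, ihb, iha]
  | smul c a _ ih =>
    have : c = 0 ∨ c = 1 := by revert c; decide
    rcases this with rfl | rfl <;> simp [ih]

lemma zOp_mul_codeProj_of_mem_span {b : Fin n → ZMod 2}
    (h : b ∈ Submodule.span (ZMod 2) (Set.range C.HZ.row)) :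
    zOp b * C.codeProj = C.codeProj := by
  induction h using Submodule.span_induction with
  | mem a ha =>
    obtain ⟨i, rfl⟩ := ha
    rw [codeProj, zGen_mul_synProj]; simp
  | zero => simp
  | add a b _ _ iha ihb => rw [← zOp_mul_zOp, mul_assoc, ihb, iha]
  | smul c a _ ih =>
    have : c = 0 ∨ c = 1 := by revert c; decide
    rcases this with rfl | rfl <;> simp [ih]

lemma dotProduct_eq_zero_of_mem_span {m : ℕ} {H : Matrix (Fin m) (Fin n) (ZMod 2)}
    {a b : Fin n → ZMod 2} (h : a ∈ Submodule.span (ZMod 2) (Set.range H.row))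
    (hb : H *ᵥ b = 0) : a ⬝ᵥ b = 0 := by
  induction h using Submodule.span_induction with
  | mem a ha => obtain ⟨i, rfl⟩ := ha; exact congrFun hb i
  | zero => simp
  | add a c _ _ iha ihc => rw [add_dotProduct, iha, ihc, add_zero]
  | smul c a _ ih => rw [smul_dotProduct, ih, smul_zero]

lemma mulVec_eq_zero_of_mem_span_X {a : Fin n → ZMod 2}
    (h : a ∈ Submodule.span (ZMod 2) (Set.range C.HX.row)) : C.HZ *ᵥ a = 0 := by
  funext j
  refine (dotProduct_comm _ _).trans (dotProduct_eq_zero_of_mem_span h ?_)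
  funext i
  exact (dotProduct_comm _ _).trans (C.row_dotProduct i j)

lemma mulVec_eq_zero_of_mem_span_Z {b : Fin n → ZMod 2}
    (h : b ∈ Submodule.span (ZMod 2) (Set.range C.HZ.row)) : C.HX *ᵥ b = 0 := by
  funext i
  refine (dotProduct_comm _ _).trans (dotProduct_eq_zero_of_mem_span h ?_)
  funext j
  exact C.row_dotProduct i j

/-- A Pauli string that is, up to sign, a product of stabilizer generators. -/
def IsStabilizer (p : PauliString n) : Prop :=
  p.1 ∈ Submodule.span (ZMod 2) (Set.range C.HX.row) ∧
    p.2 ∈ Submodule.span (ZMod 2) (Set.range C.HZ.row)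

lemma isNontrivialLogical_iff (p : PauliString n) :
    C.IsNontrivialLogical p ↔ C.syndromeOf p = 0 ∧ ¬ C.IsStabilizer p := by
  rw [IsNontrivialLogical, syndromeOf, IsStabilizer, Prod.mk_eq_zero]
  tauto

variable {C} in
lemma IsStabilizer.syndromeOf {p : PauliString n} (h : C.IsStabilizer p) : C.syndromeOf p = 0 :=
  Prod.ext (C.mulVec_eq_zero_of_mem_span_Z h.2) (C.mulVec_eq_zero_of_mem_span_X h.1)

lemma syndromeOf_add (p q : PauliString n) :
    C.syndromeOf (p + q) = C.syndromeOf p + C.syndromeOf q := by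
  simp [syndromeOf, Matrix.mulVec_add]

end CSSCode

/-! ### Pivoted disjoint support partitions -/

/-- Reduced row echelon form over `ℤ/2`. The set `J` of pivots is a minimal set of coordinates that
determines the vectors of `W`: by minimality some nonzero vector of `W` vanishes on `J \ {j}`, and
it has to be `1` at `j`. -/
lemma exists_reduced_echelon {n : ℕ} (W : Submodule (ZMod 2) (Fin n → ZMod 2)) :
    ∃ (J : Finset (Fin n)) (w : Fin n → Fin n → ZMod 2),
      (∀ v ∈ W, (∀ j ∈ J, v j = 0) → v = 0) ∧
      ∀ j ∈ J, w j ∈ W ∧ ∀ j' ∈ J, w j j' = if j' = j then 1 else 0 := by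
  classical
  let 𝒥 : Finset (Finset (Fin n)) :=
    Finset.univ.filter fun J => ∀ v ∈ W, (∀ j ∈ J, v j = 0) → v = 0
  have hne : 𝒥.Nonempty :=
    ⟨Finset.univ, Finset.mem_filter.2
      ⟨Finset.mem_univ _, fun v _ hv => funext fun j => hv j (Finset.mem_univ j)⟩⟩
  obtain ⟨J, hJ, hmin⟩ := Finset.exists_min_image 𝒥 Finset.card hne
  have hdet : ∀ v ∈ W, (∀ j ∈ J, v j = 0) → v = 0 := by simpa [𝒥] using hJ
  have hrow : ∀ j ∈ J, ∃ v ∈ W, ∀ j' ∈ J, v j' = if j' = j then 1 else 0 := by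
    intro j hj
    have hnot : J.erase j ∉ 𝒥 := fun h =>
      absurd (hmin _ h) (not_le.2 (Finset.card_erase_lt_of_mem hj))
    simp only [𝒥, Finset.mem_filter, Finset.mem_univ, true_and, not_forall] at hnot
    obtain ⟨v, hv, hvan, hv0⟩ := hnot
    have hvj : v j ≠ 0 := fun h0 => hv0 <| hdet v hv fun j' hj' => by
      by_cases h : j' = j
      · rw [h, h0]
      · exact hvan j' (Finset.mem_erase.2 ⟨h, hj'⟩)
    refine ⟨v, hv, fun j' hj' => ?_⟩
    split_ifs with h
    · rw [h]; revert hvj; generalize v j = t; revert t; decide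
    · exact hvan j' (Finset.mem_erase.2 ⟨h, hj'⟩)
  choose! w hw using hrow
  exact ⟨J, w, hdet, hw⟩

/-- The indicator vector of a set of sites. -/
def indicator {n : ℕ} (S : Finset (Fin n)) : Fin n → ZMod 2 := fun j => if j ∈ S then 1 else 0

lemma restrict_eq_indicator {n : ℕ} (L : PauliString n) (S : Finset (Fin n)) :
    restrict L S = (indicator S * L.1, indicator S * L.2) := by
  ext j <;> simp [restrict, indicator]

lemma indicator_support {n : ℕ} (v : Fin n → ZMod 2) :
    indicator (Finset.univ.filter fun j => v j ≠ 0) = v := by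
  ext j
  simp only [indicator, Finset.mem_filter, Finset.mem_univ, true_and]
  generalize v j = t; revert t; decide

namespace CSSCode

variable {n : ℕ} (C : CSSCode n)

lemma IsStabilizer.add {C : CSSCode n} {p q : PauliString n} (hp : C.IsStabilizer p)
    (hq : C.IsStabilizer q) : C.IsStabilizer (p + q) :=
  ⟨add_mem hp.1 hq.1, add_mem hp.2 hq.2⟩

/-- No nontrivial part of `L` is a stabilizer. -/
def IsReduced (L : PauliString n) : Prop :=
  ∀ S ⊆ supp L, S.Nonempty → ¬ C.IsStabilizer (restrict L S)

/-- A representative of least weight is reduced, since a stabilizer that is a part of it could be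
removed. -/
lemma exists_isReduced (p : PauliString n) :
    ∃ L, C.IsStabilizer (L + p) ∧ C.IsReduced L := by
  classical
  obtain ⟨L, hL, hmin⟩ := Finset.exists_min_image
    (Finset.univ.filter fun L => C.IsStabilizer (L + p)) (fun L => (supp L).card)
    ⟨p, by
      rw [Finset.mem_filter, show p + p = 0 from Prod.ext (bits_add_self _) (bits_add_self _)]
      exact ⟨Finset.mem_univ _, zero_mem _, zero_mem _⟩⟩
  simp only [Finset.mem_filter, Finset.mem_univ, true_and] at hL hmin
  refine ⟨L, hL, fun S hS hne hstab => ?_⟩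
  have hsum : L + restrict L S = restrict L Sᶜ := by
    ext j <;> by_cases h : j ∈ S <;> simp [restrict, h, CharTwo.add_self_eq_zero]
  have hle := hmin (restrict L Sᶜ) (by
    rw [← hsum, add_right_comm]; exact hL.add hstab)
  rw [supp_restrict] at hle
  obtain ⟨j, hj⟩ := hne
  refine absurd hle (not_le.2 (Finset.card_lt_card ?_))
  refine (Finset.ssubset_iff_of_subset Finset.inter_subset_left).2 ⟨j, hS hj, ?_⟩
  simp [hj]

/-- The sets `S` of sites of `L`, as indicator vectors, such that the restriction of `L` to `S`
commutes with all stabilizers. -/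
def logicalParts (L : PauliString n) : Submodule (ZMod 2) (Fin n → ZMod 2) where
  carrier := {v | (∀ j, j ∉ supp L → v j = 0) ∧ C.syndromeOf (v * L.1, v * L.2) = 0}
  zero_mem' := by
    refine ⟨fun _ _ => rfl, ?_⟩
    simp only [zero_mul]
    exact C.syndromeOf_zero
  add_mem' := by
    rintro v w ⟨hv, hv'⟩ ⟨hw, hw'⟩
    refine ⟨fun j hj => by rw [Pi.add_apply, hv j hj, hw j hj, add_zero], ?_⟩
    have := C.syndromeOf_add (v * L.1, v * L.2) (w * L.1, w * L.2)
    rw [hv', hw', add_zero, Prod.mk_add_mk, ← add_mul, ← add_mul] at this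
    exact this
  smul_mem' := by
    rintro c v ⟨hv, hv'⟩
    have : c = 0 ∨ c = 1 := by revert c; decide
    rcases this with rfl | rfl
    · refine ⟨fun _ _ => by simp, ?_⟩
      simp only [zero_smul, zero_mul]
      exact C.syndromeOf_zero
    · simpa using ⟨hv, hv'⟩

lemma indicator_mem_logicalParts {L : PauliString n} {S : Finset (Fin n)} (hS : S ⊆ supp L) :
    indicator S ∈ C.logicalParts L ↔ C.syndromeOf (restrict L S) = 0 := by
  rw [restrict_eq_indicator]
  exact ⟨fun h => h.2, fun h => ⟨fun j hj => if_neg fun h' => hj (hS h'), h⟩⟩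

/-- The blocks `D m` form a partition of the support of `L` into an odd number of sets, and no
union of blocks commutes with all stabilizers, apart from the empty and the full one. -/
structure IsBlockPartition (L : PauliString n) {M : ℕ} (D : Fin M → Finset (Fin n)) : Prop where
  disjoint : Pairwise fun m m' => Disjoint (D m) (D m')
  cover : Finset.univ.biUnion D = supp L
  odd : Odd M
  syndromeOf_eq_zero_iff : ∀ R : Finset (Fin M),
    C.syndromeOf (restrict L (R.biUnion D)) = 0 ↔ R = ∅ ∨ R = Finset.univ

/-- The product of the blocks in a list is the restriction of `L` to their union. -/
lemma list_prod_pauliOp_blocks (L : PauliString n) {M : ℕ} {D : Fin M → Finset (Fin n)}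
    (hD : Pairwise fun m m' => Disjoint (D m) (D m')) (R : Finset (Fin M)) (l : List (Fin M))
    (hl : l.Nodup) :
    (l.map fun m => if m ∈ R then pauliOp (restrict L (D m)) else 1).prod =
      pauliOp (restrict L ((l.toFinset ∩ R).biUnion D)) := by
  induction l with
  | nil => simp [restrict_empty]
  | cons m l ih =>
    obtain ⟨hm, hl⟩ := List.nodup_cons.1 hl
    rw [List.map_cons, List.prod_cons, ih hl, List.toFinset_cons]
    split_ifs with hmR
    · rw [pauliOp_restrict_mul, Finset.insert_inter_of_mem hmR, Finset.biUnion_insert]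
      rw [Finset.disjoint_biUnion_right]
      intro m' hm'
      refine hD ?_
      rintro rfl
      exact hm (by simpa using (Finset.mem_inter.1 hm').1)
    · rw [one_mul, Finset.insert_inter_of_notMem hmR]

variable {C}

lemma IsBlockPartition.isDisjointSupportPartition {L : PauliString n} {M : ℕ}
    {D : Fin M → Finset (Fin n)} (h : C.IsBlockPartition L D) :
    C.IsDisjointSupportPartition L fun m => restrict L (D m) := by
  have hprod := fun R => list_prod_pauliOp_blocks L h.disjoint R _ (List.nodup_finRange M)
  refine ⟨fun m m' hne => ?_, ?_, h.odd, fun R hne hR => ?_⟩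
  · dsimp only
    rw [supp_restrict, supp_restrict]
    exact (h.disjoint hne).mono Finset.inter_subset_right Finset.inter_subset_right
  · have := hprod Finset.univ
    simp only [Finset.mem_univ, if_true, List.toFinset_finRange, Finset.inter_self, h.cover,
      restrict_supp] at this
    rw [List.ofFn_eq_map, this]
  · rw [List.ofFn_eq_map, hprod R, List.toFinset_finRange, Finset.univ_inter, mul_assoc]
    conv_lhs => enter [1]; rw [codeProj]
    rw [synProj_mul_pauliOp_mul_codeProj, if_neg]
    rw [h.syndromeOf_eq_zero_iff, not_or]
    exact ⟨hne.ne_empty, hR⟩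

/-- Every nontrivial reduced logical operator has a pivoted partition: one block contains the
pivots of an echelon form of `logicalParts`, together with one further site if the parity of the
number of blocks requires it; the other blocks are the remaining sites. A union of blocks contains
all pivots or none, so if it commutes with all stabilizers, then it is everything or empty. -/
lemma IsReduced.exists_partition {L : PauliString n} (hred : C.IsReduced L)
    (hsyn : C.syndromeOf L = 0) :
    ∃ (M : ℕ) (D : Fin M → Finset (Fin n)), C.IsBlockPartition L D ∧
      C.IsPivoted L fun m => restrict L (D m) := by
  classical
  obtain ⟨J, w, hdet, hw⟩ := exists_reduced_echelon (C.logicalParts L)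
  set row : Fin n → Finset (Fin n) := fun j => Finset.univ.filter fun q => w j q ≠ 0 with hrow
  have hrowsub : ∀ j ∈ J, row j ⊆ supp L := fun j hj q hq => by
    by_contra hqL
    exact (Finset.mem_filter.1 hq).2 ((hw j hj).1.1 q hqL)
  have hrowJ : ∀ j ∈ J, row j ∩ J = {j} := by
    intro j hj
    ext q
    simp only [hrow, Finset.mem_inter, Finset.mem_filter, Finset.mem_univ, true_and,
      Finset.mem_singleton]
    constructor
    · rintro ⟨h1, h2⟩
      rw [(hw j hj).2 q h2] at h1
      by_contra h; simp [h] at h1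
    · rintro rfl
      exact ⟨by simp [(hw q hj).2 q hj], hj⟩
  have hJL : J ⊆ supp L := fun j hj => hrowsub j hj
    (Finset.mem_inter.1 ((hrowJ j hj).symm ▸ Finset.mem_singleton_self j)).1
  have hfull : indicator (supp L) ∈ C.logicalParts L := by
    rw [C.indicator_mem_logicalParts subset_rfl, restrict_supp, hsyn]
  have hlog : ∀ j ∈ J, C.IsNontrivialLogical (restrict L (row j)) := by
    intro j hj
    rw [isNontrivialLogical_iff, ← C.indicator_mem_logicalParts (hrowsub j hj), hrow,
      indicator_support]
    exact ⟨(hw j hj).1, hred _ (hrowsub j hj)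
      ⟨j, (Finset.mem_inter.1 ((hrowJ j hj).symm ▸ Finset.mem_singleton_self j)).1⟩⟩
  have hodd : ∀ q ∈ supp L, Odd (J.filter fun j => q ∈ row j).card := by
    -- the sum of all rows agrees with the indicator of `supp L` on the pivots
    have hsum : indicator (supp L) - ∑ j ∈ J, w j = 0 := by
      refine hdet _ (sub_mem hfull (sum_mem fun j hj => (hw j hj).1)) fun q hq => ?_
      rw [Pi.sub_apply, Finset.sum_apply, Finset.sum_congr rfl fun j hj => (hw j hj).2 q hq,
        Finset.sum_ite_eq, if_pos hq, indicator, if_pos (hJL hq), sub_self]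
    intro q hq
    have hq1 := congrFun hsum q
    rw [Pi.sub_apply, Finset.sum_apply, indicator, if_pos hq, Pi.zero_apply, sub_eq_zero] at hq1
    have hcard : ((J.filter fun j => q ∈ row j).card : ZMod 2) = 1 := by
      rw [hq1, Finset.card_filter, Nat.cast_sum]
      refine Finset.sum_congr rfl fun j _ => ?_
      simp only [hrow, Finset.mem_filter, Finset.mem_univ, true_and]
      generalize w j q = t; revert t; decide
    exact ZMod.natCast_eq_one_iff_odd.1 hcard
  -- `E` holds the further site that makes the number of blocks odd, if one is needed
  obtain ⟨E, hEsub, hEcard, hEven⟩ : ∃ E ⊆ supp L \ J, E.card ≤ 1 ∧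
      Even ((supp L \ J) \ E).card := by
    by_cases h : Even (supp L \ J).card
    · exact ⟨∅, by simp, by simp, by simpa using h⟩
    · rw [Nat.not_even_iff_odd] at h
      obtain ⟨q, hq⟩ := Finset.card_pos.1 h.pos
      refine ⟨{q}, by simpa using hq, by simp, ?_⟩
      rw [Finset.card_sdiff_of_subset (by simpa using hq), Finset.card_singleton]
      exact Nat.Odd.sub_odd h odd_one
  set T := (supp L \ J) \ E
  let e : Fin T.card ≃ T := T.equivFin.symm
  let D : Fin (T.card + 1) → Finset (Fin n) := Fin.cons (J ∪ E) fun i => {(e i : Fin n)}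
  have hD0 : D 0 = J ∪ E := rfl
  have hDs : ∀ i, D (Fin.succ i) = {(e i : Fin n)} := fun i => rfl
  have heT : ∀ i, (e i : Fin n) ∈ supp L ∧ (e i : Fin n) ∉ J ∧ (e i : Fin n) ∉ E := fun i => by
    obtain ⟨h1, h2⟩ := Finset.mem_sdiff.1 (e i).2
    exact ⟨(Finset.mem_sdiff.1 h1).1, (Finset.mem_sdiff.1 h1).2, h2⟩
  have hEL : ∀ q ∈ E, q ∈ supp L ∧ q ∉ J := fun q hq => Finset.mem_sdiff.1 (hEsub hq)
  have hDsub : ∀ m, D m ⊆ supp L := by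
    intro m
    refine Fin.cases ?_ (fun i => ?_) m
    · rw [hD0]
      exact Finset.union_subset hJL fun q hq => (hEL q hq).1
    · rw [hDs, Finset.singleton_subset_iff]; exact (heT i).1
  have hdisj : Pairwise fun m m' => Disjoint (D m) (D m') := by
    intro m m'
    refine Fin.cases ?_ (fun i => ?_) m <;> refine Fin.cases ?_ (fun i' => ?_) m'
    · exact fun h => (h rfl).elim
    · intro _
      rw [hD0, hDs, Finset.disjoint_singleton_right, Finset.mem_union]
      have := heT i'; tauto
    · intro _
      rw [hD0, hDs, Finset.disjoint_singleton_left, Finset.mem_union]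
      have := heT i; tauto
    · intro h
      rw [hDs, hDs, Finset.disjoint_singleton]
      exact fun h' => h (by rw [e.injective (Subtype.ext h')])
  have hcover : Finset.univ.biUnion D = supp L := by
    refine Finset.Subset.antisymm (Finset.biUnion_subset.2 fun m _ => hDsub m) fun q hq => ?_
    rw [Finset.mem_biUnion]
    by_cases hqT : q ∈ T
    · exact ⟨Fin.succ (e.symm ⟨q, hqT⟩), Finset.mem_univ _, by simp [hDs]⟩
    · refine ⟨0, Finset.mem_univ _, ?_⟩
      rw [hD0, Finset.mem_union]
      by_contra hn
      rw [not_or] at hn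
      exact hqT (Finset.mem_sdiff.2 ⟨Finset.mem_sdiff.2 ⟨hq, hn.1⟩, hn.2⟩)
  have hmem : ∀ (R : Finset (Fin (T.card + 1))) (m) (q), q ∈ D m →
      (q ∈ R.biUnion D ↔ m ∈ R) := by
    intro R m q hq
    rw [Finset.mem_biUnion]
    refine ⟨fun ⟨m', hm', hq'⟩ => ?_, fun h => ⟨m, h, hq⟩⟩
    by_contra hm
    exact Finset.disjoint_left.1 (hdisj fun h : m = m' => hm (h ▸ hm')) hq hq'
  -- the nontrivial implication: a union of blocks in `logicalParts` either contains `J`, and then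
  -- agrees with `supp L`, or is disjoint from `J`, and then is empty
  refine ⟨T.card + 1, D, ⟨hdisj, hcover, hEven.add_one, fun R => ⟨fun h => ?_, ?_⟩⟩,
    J, row, 0, fun j hj => ⟨hrowsub j hj, hrowJ j hj, hlog j hj⟩, hodd, ?_, ?_, ?_⟩
  · have hU : R.biUnion D ⊆ supp L := Finset.biUnion_subset.2 fun m _ => hDsub m
    rw [← C.indicator_mem_logicalParts hU] at h
    by_cases h0 : (0 : Fin (T.card + 1)) ∈ R
    · right
      have heq := hdet _ (sub_mem hfull h) fun j hj => by
        have h1 := (hmem R 0 j (by rw [hD0]; exact Finset.mem_union_left _ hj)).2 h0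
        rw [Pi.sub_apply, indicator, indicator, if_pos h1, if_pos (hJL hj), sub_self]
      rw [Finset.eq_univ_iff_forall]
      refine Fin.cases h0 fun i => ?_
      have h2 := congrFun heq (e i)
      by_contra hi
      rw [Pi.sub_apply, indicator, indicator, if_pos (heT i).1,
        if_neg fun h' => hi ((hmem R i.succ _ (by simp [hDs])).1 h')] at h2
      simp at h2
    · left
      have heq := hdet _ h fun j hj => if_neg fun h' => h0
        ((hmem R 0 j (by rw [hD0]; exact Finset.mem_union_left _ hj)).1 h')
      rw [Finset.eq_empty_iff_forall_notMem]
      refine Fin.cases h0 fun i hi => ?_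
      have h2 := congrFun heq (e i)
      rw [indicator, if_pos ((hmem R i.succ _ (by simp [hDs])).2 hi)] at h2
      simp at h2
  · rintro (rfl | rfl)
    · rw [Finset.biUnion_empty, restrict_empty, syndromeOf_zero]
    · rw [hcover, restrict_supp, hsyn]
  · dsimp only
    rw [supp_restrict, hD0]
    exact Finset.subset_inter hJL Finset.subset_union_left
  · dsimp only
    rw [supp_restrict, hD0]
    refine (Finset.card_le_card fun q hq => ?_).trans hEcard
    simp only [Finset.mem_sdiff, Finset.mem_inter, Finset.mem_union] at hq
    tauto
  · refine Fin.cases (fun h => (h rfl).elim) fun i _ => ?_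
    rw [supp_restrict, Finset.inter_eq_right.2 (hDsub _), hDs, Finset.card_singleton]

end CSSCode

/-! ### The Kraus operators of a layer of rotations on a block partition -/

namespace CSSCode

variable {n : ℕ} {C : CSSCode n} {L : PauliString n} {M : ℕ} {D : Fin M → Finset (Fin n)}

/-- The coefficient of the product of the blocks in `R` in the expansion of
`∏ₘ (cos Φₘ + i sin Φₘ Pₘ)`. -/
noncomputable def amp (Φ : Fin M → ℝ) (R : Finset (Fin M)) : ℂ :=
  (∏ m ∈ R, (Complex.I * Real.sin (Φ m))) * ∏ m ∈ Rᶜ, (Real.cos (Φ m) : ℂ)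

/-- The real factor of `amp`. -/
noncomputable def realAmp (Φ : Fin M → ℝ) (R : Finset (Fin M)) : ℝ :=
  (∏ m ∈ R, Real.sin (Φ m)) * ∏ m ∈ Rᶜ, Real.cos (Φ m)

lemma amp_eq (Φ : Fin M → ℝ) (R : Finset (Fin M)) :
    amp Φ R = Complex.I ^ R.card * (realAmp Φ R : ℂ) := by
  rw [amp, realAmp, Finset.prod_mul_distrib, Finset.prod_const]
  push_cast
  ring

lemma sum_normSq_amp (Φ : Fin M → ℝ) : ∑ R, Complex.normSq (amp Φ R) = 1 := by
  have h := Finset.prod_add (fun m => Real.sin (Φ m) ^ 2) (fun m => Real.cos (Φ m) ^ 2) Finset.univ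
  simp only [Real.sin_sq_add_cos_sq, Finset.prod_const_one, Finset.powerset_univ] at h
  rw [h]
  refine Finset.sum_congr rfl fun R _ => ?_
  rw [amp_eq, map_mul, map_pow, Complex.normSq_I, one_pow, one_mul, Complex.normSq_ofReal, realAmp,
    Finset.prod_pow, Finset.prod_pow, Finset.compl_eq_univ_sdiff]
  ring

lemma list_prod_rot (L : PauliString n) (hD : Pairwise fun m m' => Disjoint (D m) (D m'))
    (Φ : Fin M → ℝ) (l : List (Fin M)) (hl : l.Nodup) :
    (l.map fun m => rot (Φ m) (pauliOp (restrict L (D m)))).prod =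
      ∑ R ∈ l.toFinset.powerset, ((∏ m ∈ R, (Complex.I * Real.sin (Φ m))) *
        ∏ m ∈ l.toFinset \ R, (Real.cos (Φ m) : ℂ)) • pauliOp (restrict L (R.biUnion D)) := by
  classical
  induction l with
  | nil => simp [restrict_empty]
  | cons m l ih =>
    obtain ⟨hm, hl⟩ := List.nodup_cons.1 hl
    have hm' : m ∉ l.toFinset := by simpa using hm
    rw [List.map_cons, List.prod_cons, ih hl, List.toFinset_cons, Finset.sum_powerset_insert hm',
      rot_eq (pauliOp_mul_self _), add_mul, smul_mul_assoc, smul_mul_assoc, one_mul,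
      Finset.mul_sum, Finset.smul_sum, Finset.smul_sum]
    congr 1 <;> refine Finset.sum_congr rfl fun R hR => ?_ <;>
      have hmR : m ∉ R := fun h => hm' (Finset.mem_powerset.1 hR h)
    · rw [Finset.insert_sdiff_of_notMem _ hmR, Finset.prod_insert (by simp [hm]), smul_smul]
      congr 1; ring
    · have hdisj : Disjoint (D m) (R.biUnion D) := by
        rw [Finset.disjoint_biUnion_right]
        exact fun m' h' => hD fun h : m = m' => hmR (h ▸ h')
      rw [mul_smul_comm, pauliOp_restrict_mul L hdisj, Finset.biUnion_insert,
        Finset.prod_insert hmR, Finset.insert_sdiff_insert, Finset.sdiff_insert_of_notMem hm',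
        smul_smul]
      congr 1; ring

lemma prod_rot_eq (L : PauliString n) (hD : Pairwise fun m m' => Disjoint (D m) (D m'))
    (Φ : Fin M → ℝ) :
    (List.ofFn fun m => rot (Φ m) (pauliOp (restrict L (D m)))).prod =
      ∑ R, amp Φ R • pauliOp (restrict L (R.biUnion D)) := by
  rw [List.ofFn_eq_map, list_prod_rot L hD Φ _ (List.nodup_finRange M), List.toFinset_finRange,
    Finset.powerset_univ]
  simp only [amp, Finset.compl_eq_univ_sdiff]

namespace IsBlockPartition

lemma mem_biUnion_iff (h : C.IsBlockPartition L D) {m : Fin M} {j : Fin n} (hj : j ∈ D m)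
    (R : Finset (Fin M)) : j ∈ R.biUnion D ↔ m ∈ R := by
  rw [Finset.mem_biUnion]
  refine ⟨fun ⟨m', hm', hq'⟩ => ?_, fun h => ⟨m, h, hj⟩⟩
  by_contra hm
  exact Finset.disjoint_left.1 (h.disjoint fun h : m = m' => hm (h ▸ hm')) hj hq'

lemma restrict_add_restrict (h : C.IsBlockPartition L D) (R R' : Finset (Fin M)) :
    restrict L (R.biUnion D) + restrict L (R'.biUnion D) =
      restrict L ((symmDiff R R').biUnion D) := by
  ext j <;> by_cases hj : ∃ m, j ∈ D m
  · obtain ⟨m, hm⟩ := hj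
    by_cases h1 : m ∈ R <;> by_cases h2 : m ∈ R' <;>
      simp only [restrict, Prod.fst_add, Pi.add_apply, h.mem_biUnion_iff hm, Finset.mem_symmDiff,
        h1, h2] <;> simp [CharTwo.add_self_eq_zero]
  · push Not at hj
    simp [restrict, hj]
  · obtain ⟨m, hm⟩ := hj
    by_cases h1 : m ∈ R <;> by_cases h2 : m ∈ R' <;>
      simp only [restrict, Prod.snd_add, Pi.add_apply, h.mem_biUnion_iff hm, Finset.mem_symmDiff,
        h1, h2] <;> simp [CharTwo.add_self_eq_zero]
  · push Not at hj
    simp [restrict, hj]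

/-- The syndrome determines a union of blocks up to complement. -/
lemma syndromeOf_eq_iff (h : C.IsBlockPartition L D) (R R' : Finset (Fin M)) :
    C.syndromeOf (restrict L (R.biUnion D)) = C.syndromeOf (restrict L (R'.biUnion D)) ↔
      R = R' ∨ R = R'ᶜ := by
  have h2 : ∀ s t : C.Syndrome, s = t ↔ s + t = 0 := by
    intro s t
    have ht : t + t = 0 := Prod.ext (bits_add_self _) (bits_add_self _)
    constructor
    · rintro rfl; exact ht
    · intro hst
      rw [← add_zero s, ← ht, ← add_assoc, hst, zero_add]
  rw [h2, ← syndromeOf_add, h.restrict_add_restrict, h.syndromeOf_eq_zero_iff,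
    ← Finset.bot_eq_empty, symmDiff_eq_bot, ← Finset.top_eq_univ, symmDiff_eq_top]
  refine or_congr_right ⟨fun hc => hc.eq_compl, ?_⟩
  rintro rfl
  exact isCompl_compl.symm

lemma ne_compl (h : C.IsBlockPartition L D) (R : Finset (Fin M)) : R ≠ Rᶜ := by
  obtain ⟨m⟩ : Nonempty (Fin M) := ⟨⟨0, h.odd.pos⟩⟩
  intro hR
  by_cases hm : m ∈ R
  · exact absurd (hR ▸ hm : m ∈ Rᶜ) (by simpa using hm)
  · exact hm (hR ▸ (by simpa using hm : m ∈ Rᶜ))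

lemma filter_syndromeOf_eq (h : C.IsBlockPartition L D) {R₀ : Finset (Fin M)} {s : C.Syndrome}
    (hs : C.syndromeOf (restrict L (R₀.biUnion D)) = s) :
    (Finset.univ.filter fun R : Finset (Fin M) =>
      C.syndromeOf (restrict L (R.biUnion D)) = s) = {R₀, R₀ᶜ} := by
  ext R
  rw [← hs]
  simp [h.syndromeOf_eq_iff]

end IsBlockPartition

/-- The function `r` chooses, for the syndrome of any product of blocks, a set of blocks with that
syndrome. -/
def IsDecoder (C : CSSCode n) (L : PauliString n) (D : Fin M → Finset (Fin n))
    (r : C.Syndrome → Finset (Fin M)) : Prop :=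
  ∀ R : Finset (Fin M),
    C.syndromeOf (restrict L ((r (C.syndromeOf (restrict L (R.biUnion D)))).biUnion D)) =
      C.syndromeOf (restrict L (R.biUnion D))

/-- The step with the rotations by the angles `Φ` on the blocks `D`, and with the product of the
blocks in `r s` as the correction for the syndrome `s`. -/
def blockStep (C : CSSCode n) (L : PauliString n) (D : Fin M → Finset (Fin n))
    (r : C.Syndrome → Finset (Fin M)) (Φ : Fin M → ℝ) : C.Step :=
  ⟨M, fun m => restrict L (D m), Φ, fun s => restrict L ((r s).biUnion D)⟩

/-- Only two complementary terms of the expansion of the rotations are compatible with a syndrome,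
and the correction turns them into the identity and `L`. -/
lemma IsBlockPartition.kraus_mul_codeProj (h : C.IsBlockPartition L D)
    {r : C.Syndrome → Finset (Fin M)}
    (hr : C.IsDecoder L D r)
    (Φ : Fin M → ℝ) (s : C.Syndrome) :
    (blockStep C L D r Φ).kraus s * C.codeProj =
      if C.syndromeOf (restrict L ((r s).biUnion D)) = s then
        (amp Φ (r s) • 1 + amp Φ (r s)ᶜ • pauliOp L) * C.codeProj else 0 := by
  have hexp : (blockStep C L D r Φ).kraus s * C.codeProj =
      pauliOp (restrict L ((r s).biUnion D)) * ∑ R ∈ Finset.univ.filter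
        (fun R : Finset (Fin M) => C.syndromeOf (restrict L (R.biUnion D)) = s),
          amp Φ R • (pauliOp (restrict L (R.biUnion D)) * C.codeProj) := by
    rw [Step.kraus, mul_assoc, mul_assoc]
    simp only [blockStep]
    rw [prod_rot_eq L h.disjoint, Finset.sum_mul, Finset.mul_sum, Finset.sum_filter]
    congr 1
    refine Finset.sum_congr rfl fun R _ => ?_
    rw [smul_mul_assoc, mul_smul_comm, synProj_mul_pauliOp_mul_codeProj]
    split_ifs <;> simp
  rw [hexp]
  split_ifs with hs
  · rw [h.filter_syndromeOf_eq hs, Finset.sum_pair (h.ne_compl _), mul_add, mul_smul_comm,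
      mul_smul_comm, ← mul_assoc, ← mul_assoc, pauliOp_mul_self, pauliOp_restrict_mul, add_mul,
      smul_mul_assoc, smul_mul_assoc]
    · congr 4
      rw [← Finset.union_biUnion, Finset.union_compl, h.cover, restrict_supp]
    · rw [Finset.disjoint_biUnion_left]
      intro m hm
      rw [Finset.disjoint_biUnion_right]
      exact fun m' hm' => h.disjoint fun e : m = m' => (Finset.mem_compl.1 hm') (e ▸ hm)
  · rw [Finset.filter_eq_empty_iff.2, Finset.sum_empty, mul_zero]
    intro R _ hR
    exact hs (hR ▸ hr R)

lemma IsBlockPartition.sum_probability (h : C.IsBlockPartition L D)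
    {r : C.Syndrome → Finset (Fin M)}
    (hr : C.IsDecoder L D r)
    (Φ : Fin M → ℝ) :
    ∑ s, (if C.syndromeOf (restrict L ((r s).biUnion D)) = s then
      Complex.normSq (amp Φ (r s)) + Complex.normSq (amp Φ (r s)ᶜ) else 0) = 1 := by
  rw [← sum_normSq_amp Φ, ← Finset.sum_fiberwise Finset.univ
    fun R : Finset (Fin M) => C.syndromeOf (restrict L (R.biUnion D))]
  refine Finset.sum_congr rfl fun s _ => ?_
  split_ifs with hs
  · rw [h.filter_syndromeOf_eq hs, Finset.sum_pair (h.ne_compl _)]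
  · rw [Finset.filter_eq_empty_iff.2, Finset.sum_empty]
    intro R _ hR
    exact hs (hR ▸ hr R)

/-! ### Ensembles of logical unitaries -/

section Ensembles

variable {ι κ : Type*}

/-- On the code space each Kraus operator of the step is a multiple of a member of the family `F`,
the squared moduli of the multiples sum to `1`, and the member `F x` occurs. -/
def StepImplements (st : C.Step) (F : ι → Op n) (x : ι) : Prop :=
  ∃ (z : C.Syndrome → ℂ) (f : C.Syndrome → ι),
    (∀ s, st.kraus s * C.codeProj = z s • (F (f s) * C.codeProj)) ∧
    ∑ s, Complex.normSq (z s) = 1 ∧ ∃ s, z s ≠ 0 ∧ f s = x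

/-- The property `StepImplements` for circuits, with one syndrome for each step. The index type
carries the angle of a rotation, or is `Unit` for a deterministic gate. -/
def Implements (c : C.Circuit) (F : ι → Op n) (x : ι) : Prop :=
  ∃ (z : (Fin c.length → C.Syndrome) → ℂ) (f : (Fin c.length → C.Syndrome) → ι),
    (∀ o, C.circuitKraus c o * C.codeProj = z o • (F (f o) * C.codeProj)) ∧
    ∑ o, Complex.normSq (z o) = 1 ∧ ∃ o, z o ≠ 0 ∧ f o = x

lemma implements_nil (F : ι → Op n) {x : ι} (h : F x = 1) : Implements (C := C) [] F x := by
  refine ⟨fun _ => 1, fun _ => x, fun o => ?_, ?_, fun i => i.elim0, one_ne_zero, rfl⟩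
  · rw [h, one_smul]; rfl
  · rw [Finset.sum_const, Finset.card_univ]; simp

lemma Implements.cons {st : C.Step} {c : C.Circuit} {F : ι → Op n} {G : κ → Op n} {x : ι} {y : κ}
    (hst : StepImplements st F x) (hF : ∀ i, Commute (F i) C.codeProj) (hc : Implements c G y) :
    Implements (st :: c) (fun p : ι × κ => G p.2 * F p.1) (x, y) := by
  obtain ⟨z, f, hz, hsum, s₀, hs₀, hfs⟩ := hst
  obtain ⟨z', f', hz', hsum', o₀, ho₀, hfo⟩ := hc
  refine ⟨fun o => z (o 0) * z' fun i => o i.succ, fun o => (f (o 0), f' fun i => o i.succ),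
    fun o => ?_, ?_, Fin.cons s₀ o₀, ?_, ?_⟩
  · rw [circuitKraus, mul_assoc, hz, (hF _).eq, mul_smul_comm, ← mul_assoc, hz', smul_mul_assoc,
      smul_smul, mul_assoc, mul_assoc, (hF _).eq]
  · rw [← hsum, Finset.sum_congr rfl fun s _ => (mul_one (Complex.normSq (z s))).symm, ← hsum']
    simp only [Finset.mul_sum]
    rw [← Fintype.sum_prod_type' (f := fun s o => Complex.normSq (z s) * Complex.normSq (z' o))]
    refine (Fintype.sum_equiv (Fin.consEquiv fun _ : Fin (c.length + 1) => C.Syndrome) _ _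
      fun p => ?_).symm
    rw [map_mul]
    rfl
  · exact mul_ne_zero hs₀ ho₀
  · exact Prod.ext hfs hfo

lemma Implements.reindex {c : C.Circuit} {F : ι → Op n} {G : κ → Op n} {x : ι} {y : κ}
    (h : Implements c F x) (g : ι → κ) (hg : ∀ i, F i = G (g i)) (hx : g x = y) :
    Implements c G y := by
  obtain ⟨z, f, hz, hsum, o, ho, hf⟩ := h
  exact ⟨z, g ∘ f, fun o => by rw [hz, hg]; rfl, hsum, o, ho, by rw [Function.comp, hf, hx]⟩

/-- Steps that implement the unitaries `u i` with certainty may be put before a circuit. -/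
lemma Implements.map_append {c : C.Circuit} {F : ι → Op n} {x : ι} (hc : Implements c F x)
    {α : Type*} {st : α → C.Step} {u : α → Op n}
    (hst : ∀ a, StepImplements (st a) (fun _ : Unit => u a) ())
    (hu : ∀ a, Commute (u a) C.codeProj) (l : List α) :
    Implements (l.map st ++ c) (fun i => F i * (l.map u).reverse.prod) x := by
  induction l with
  | nil => simpa using hc
  | cons a l ih =>
    refine (Implements.cons (hst a) (fun _ => hu a) ih).reindex Prod.snd (fun p => ?_) rfl
    simp [mul_assoc]

lemma Implements.realizes {c : C.Circuit} {F : ι → Op n} {x : ι} (hc : Implements c F x)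
    (hF : ∀ i, C.IsLogicalUnitary (F i)) :
    ∃ (p : (Fin c.length → C.Syndrome) → ℝ) (f : (Fin c.length → C.Syndrome) → ι),
      C.Realizes c p (fun o => F (f o)) ∧ ∃ o, 0 < p o ∧ f o = x := by
  obtain ⟨z, f, hz, hsum, o, ho, hf⟩ := hc
  refine ⟨fun o => Complex.normSq (z o), f,
    ⟨fun o => Complex.normSq_nonneg _, hsum, fun o => hF _, fun ρ hρ o => ?_⟩,
    o, Complex.normSq_pos.2 ho, hf⟩
  have hρ' : C.codeProj * ρ * C.codeProjᴴ = ρ := by rw [conjTranspose_codeProj, hρ.2.2]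
  -- only the action of `K` on the code space matters, since `ρ = Π₀ ρ Π₀ᴴ`
  have key : ∀ K : Op n, K * ρ * Kᴴ = (K * C.codeProj) * ρ * (K * C.codeProj)ᴴ := by
    intro K
    rw [Matrix.conjTranspose_mul]
    conv_lhs => rw [← hρ']
    simp only [mul_assoc]
  rw [key, hz, key (F (f o)), Matrix.conjTranspose_smul, smul_mul_assoc, smul_mul_assoc,
    mul_smul_comm, smul_smul, Complex.star_def, Complex.mul_conj]

lemma StepImplements.implements {st : C.Step} {F : ι → Op n} {x : ι}
    (h : StepImplements st F x) (hF : ∀ i, Commute (F i) C.codeProj) : Implements [st] F x :=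
  (Implements.cons h hF (implements_nil (fun _ : Unit => 1) (x := ()) rfl)).reindex Prod.fst
    (fun _ => one_mul _) rfl

/-- A step on a block partition implements members of `F` if this holds for the combination
`amp (r s) + amp (r s)ᶜ L` for each syndrome `s` that occurs. -/
lemma IsBlockPartition.stepImplements (h : C.IsBlockPartition L D)
    {r : C.Syndrome → Finset (Fin M)}
    (hr : C.IsDecoder L D r)
    (Φ : Fin M → ℝ) {F : ι → Op n}
    (hF : ∀ s, C.syndromeOf (restrict L ((r s).biUnion D)) = s → ∃ (i : ι) (w : ℂ),
      (amp Φ (r s) • 1 + amp Φ (r s)ᶜ • pauliOp L) * C.codeProj = w • (F i * C.codeProj) ∧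
      Complex.normSq w = Complex.normSq (amp Φ (r s)) + Complex.normSq (amp Φ (r s)ᶜ))
    {s₀ : C.Syndrome} {x : ι} {w₀ : ℂ}
    (hs₀ : C.syndromeOf (restrict L ((r s₀).biUnion D)) = s₀)
    (hx : (amp Φ (r s₀) • 1 + amp Φ (r s₀)ᶜ • pauliOp L) * C.codeProj = w₀ • (F x * C.codeProj))
    (hw : Complex.normSq w₀ = Complex.normSq (amp Φ (r s₀)) + Complex.normSq (amp Φ (r s₀)ᶜ))
    (hne : w₀ ≠ 0) : StepImplements (blockStep C L D r Φ) F x := by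
  classical
  have hall : ∀ s, ∃ (i : ι) (w : ℂ),
      (blockStep C L D r Φ).kraus s * C.codeProj = w • (F i * C.codeProj) ∧
      Complex.normSq w = (if C.syndromeOf (restrict L ((r s).biUnion D)) = s then
        Complex.normSq (amp Φ (r s)) + Complex.normSq (amp Φ (r s)ᶜ) else 0) ∧
      (s = s₀ → w ≠ 0 ∧ i = x) := by
    intro s
    rw [h.kraus_mul_codeProj hr]
    by_cases hs : s = s₀
    · subst hs
      rw [if_pos hs₀, if_pos hs₀]
      exact ⟨x, w₀, hx, hw, fun _ => ⟨hne, rfl⟩⟩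
    · split_ifs with hss
      · obtain ⟨i, w, h1, h2⟩ := hF s hss
        exact ⟨i, w, h1, h2, fun e => (hs e).elim⟩
      · exact ⟨x, 0, by simp, by simp, fun e => (hs e).elim⟩
  choose f z hz hn h0 using hall
  refine ⟨z, f, hz, ?_, s₀, h0 s₀ rfl⟩
  rw [Finset.sum_congr rfl fun s _ => hn s, h.sum_probability hr]

lemma IsBlockPartition.exists_stepImplements (h : C.IsBlockPartition L D)
    {r : C.Syndrome → Finset (Fin M)}
    (hr : C.IsDecoder L D r)
    (Φ : Fin M → ℝ) {F : ι → Op n}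
    (hF : ∀ s, C.syndromeOf (restrict L ((r s).biUnion D)) = s → ∃ (i : ι) (w : ℂ),
      (amp Φ (r s) • 1 + amp Φ (r s)ᶜ • pauliOp L) * C.codeProj = w • (F i * C.codeProj) ∧
      Complex.normSq w = Complex.normSq (amp Φ (r s)) + Complex.normSq (amp Φ (r s)ᶜ)) :
    ∃ x, StepImplements (blockStep C L D r Φ) F x := by
  obtain ⟨s, -, hs⟩ := Finset.exists_ne_zero_of_sum_ne_zero
    ((h.sum_probability hr Φ).trans_ne one_ne_zero)
  split_ifs at hs with hss
  · obtain ⟨i, w, h1, h2⟩ := hF s hss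
    exact ⟨i, h.stepImplements hr Φ hF hss h1 h2 fun h0 => hs (by rw [← h2, h0, map_zero])⟩
  · exact (hs rfl).elim

end Ensembles

end CSSCode

/-! ### Angles and corrections -/

namespace CSSCode

variable {n : ℕ} {C : CSSCode n} {L : PauliString n} {M : ℕ} {D : Fin M → Finset (Fin n)}
  {A : Op n}

/-- Since `M` is odd, the two terms of a syndrome have a relative phase `± i`, so that they add up
to a multiple of a rotation. -/
lemma exists_rot_of_odd (hA : A * A = 1) {c c' : ℕ} (h : Odd (c + c')) (x y : ℝ) :
    ∃ (φ : ℝ) (w : ℂ), (Complex.I ^ c * x) • (1 : Op n) + (Complex.I ^ c' * y) • A =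
        w • rot φ A ∧
      Complex.normSq w = Complex.normSq (Complex.I ^ c * x) +
        Complex.normSq (Complex.I ^ c' * y) := by
  have hc : ((c' : ℕ) : ZMod 2) = ((c + 1 : ℕ) : ZMod 2) := by
    rw [ZMod.natCast_eq_natCast_iff']
    have := Nat.odd_iff.1 h
    omega
  obtain ⟨η, hη, hI⟩ : ∃ η : ℝ, η * η = 1 ∧ Complex.I ^ c' = Complex.I ^ c * (Complex.I * η) := by
    rcases I_pow_eq_or_of_cast_eq hc with h | h
    · exact ⟨1, by norm_num, by rw [h, pow_succ]; simp⟩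
    · exact ⟨-1, by norm_num, by rw [h, pow_succ]; simp⟩
  -- the sum is `i ^ c * (x + i * (η * y) * A)`: the angle is the argument of `x + i * (η * y)`
  set u : ℂ := ⟨x, η * y⟩ with hu
  have hcos : (‖u‖ : ℂ) * Real.cos u.arg = x := by
    exact_mod_cast (Complex.norm_mul_cos_arg u)
  have hsin : (‖u‖ : ℂ) * Real.sin u.arg = η * y := by
    exact_mod_cast (Complex.norm_mul_sin_arg u)
  refine ⟨u.arg, Complex.I ^ c * ‖u‖, ?_, ?_⟩
  · rw [rot_eq hA, smul_add, smul_smul, smul_smul, hI, mul_assoc _ (‖u‖ : ℂ), hcos,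
      mul_left_comm (Complex.I ^ c * (‖u‖ : ℂ)), mul_assoc (Complex.I ^ c) (‖u‖ : ℂ), hsin]
    congr 2
    ring
  · rw [map_mul, map_mul, map_mul, map_pow, map_pow, Complex.normSq_I, one_pow, one_pow, one_mul,
      one_mul, one_mul, Complex.normSq_ofReal, Complex.normSq_ofReal, Complex.normSq_ofReal,
      Complex.norm_mul_self_eq_normSq, hu, Complex.normSq_mk]
    linear_combination (y * y) * hη

lemma exists_eq_pow_of_odd (hM : Odd M) (x : ℝ) : ∃ a, x = a ^ M := by
  rcases le_total 0 x with hx | hx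
  · exact ⟨x ^ (M⁻¹ : ℝ), (Real.rpow_inv_natCast_pow hx hM.pos.ne').symm⟩
  · refine ⟨-(-x) ^ (M⁻¹ : ℝ), ?_⟩
    rw [hM.neg_pow, Real.rpow_inv_natCast_pow (neg_nonneg.2 hx) hM.pos.ne', neg_neg]

/-- The map `θ ↦ (cosᴹ θ : sinᴹ θ)` onto the directions in the plane is surjective for odd `M`. -/
lemma exists_angle_of_odd (hM : Odd M) (x y : ℝ) (h : x ≠ 0 ∨ y ≠ 0) :
    ∃ θ c : ℝ, c ≠ 0 ∧ Real.cos θ ^ M = c * x ∧ Real.sin θ ^ M = c * y := by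
  obtain ⟨a, rfl⟩ := exists_eq_pow_of_odd hM x
  obtain ⟨b, rfl⟩ := exists_eq_pow_of_odd hM y
  have hu : (⟨a, b⟩ : ℂ) ≠ 0 := by
    intro h0
    rw [Complex.ext_iff] at h0
    simp only [Complex.zero_re, Complex.zero_im] at h0
    rw [h0.1, h0.2, zero_pow hM.pos.ne'] at h
    simp at h
  refine ⟨Complex.arg ⟨a, b⟩, (‖(⟨a, b⟩ : ℂ)‖ ^ M)⁻¹,
    inv_ne_zero (pow_ne_zero _ (norm_ne_zero_iff.2 hu)), ?_, ?_⟩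
  · rw [Complex.cos_arg hu, div_pow]; ring
  · rw [Complex.sin_arg, div_pow]; ring

lemma represents_iff (A : Op n) : C.Represents L A ↔
    ∃ ε : ℝ, ε * ε = 1 ∧ pauliOp L * C.codeProj = (ε : ℂ) • (A * C.codeProj) := by
  constructor
  · rintro (h | h)
    · exact ⟨1, by norm_num, by simpa using h⟩
    · exact ⟨-1, by norm_num, by simpa using h⟩
  · rintro ⟨ε, hε, h⟩
    rcases mul_self_eq_one_iff.1 hε with rfl | rfl
    · left; simpa using h
    · right; simpa using h

lemma smul_one_add_smul_mul_codeProj {ε : ℝ}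
    (hε : pauliOp L * C.codeProj = (ε : ℂ) • (A * C.codeProj)) (a b : ℂ) :
    (a • 1 + b • pauliOp L) * C.codeProj = (a • 1 + (b * ε) • A) * C.codeProj := by
  rw [add_mul, add_mul, smul_mul_assoc b, hε, smul_smul, smul_mul_assoc (b * ε)]

namespace IsBlockPartition

lemma odd_card_add_card_compl (h : C.IsBlockPartition L D) (R : Finset (Fin M)) :
    Odd (R.card + Rᶜ.card) := by
  rw [Finset.card_add_card_compl, Fintype.card_fin]
  exact h.odd

/-- A decoder may be chosen with a property that one of any two complementary sets has. -/
lemma exists_decoder (h : C.IsBlockPartition L D) (Q : Finset (Fin M) → Prop)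
    (hQ : ∀ R, Q R ∨ Q Rᶜ) : ∃ r, C.IsDecoder L D r ∧ ∀ s, Q (r s) := by
  have key : ∀ s, ∃ R, Q R ∧
      ((∃ R' : Finset (Fin M), C.syndromeOf (restrict L (R'.biUnion D)) = s) →
        C.syndromeOf (restrict L (R.biUnion D)) = s) := by
    intro s
    by_cases hs : ∃ R' : Finset (Fin M), C.syndromeOf (restrict L (R'.biUnion D)) = s
    · obtain ⟨R', rfl⟩ := hs
      rcases hQ R' with hR | hR
      · exact ⟨R', hR, fun _ => rfl⟩
      · exact ⟨R'ᶜ, hR, fun _ => (h.syndromeOf_eq_iff _ _).2 (Or.inr rfl)⟩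
    · rcases hQ ∅ with hR | hR
      · exact ⟨∅, hR, fun h => (hs h).elim⟩
      · exact ⟨∅ᶜ, hR, fun h => (hs h).elim⟩
  choose r hr hr' using key
  exact ⟨r, fun R => hr' _ ⟨R, rfl⟩, hr⟩

/-- A decoder that corrects nothing for the trivial syndrome. -/
lemma exists_decoder_zero (h : C.IsBlockPartition L D) : ∃ r, C.IsDecoder L D r ∧ r 0 = ∅ := by
  have hne : (∅ : Finset (Fin M)) ≠ Finset.univ := fun e =>
    h.ne_compl ∅ (by rw [Finset.compl_empty]; exact e)
  obtain ⟨r, hr, hQ⟩ := h.exists_decoder (fun R => R ≠ Finset.univ) fun R => by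
    by_cases hR : R = Finset.univ
    · right; rw [hR, Finset.compl_univ]; exact hne
    · left; exact hR
  refine ⟨r, hr, ((h.syndromeOf_eq_zero_iff _).1 ?_).resolve_right (hQ 0)⟩
  have := hr ∅
  rwa [Finset.biUnion_empty, restrict_empty, syndromeOf_zero] at this

lemma exists_rot (h : C.IsBlockPartition L D) (hA : A * A = 1) (hL : C.Represents L A)
    (Φ : Fin M → ℝ) (R : Finset (Fin M)) : ∃ (φ : ℝ) (w : ℂ),
      (amp Φ R • 1 + amp Φ Rᶜ • pauliOp L) * C.codeProj = w • (rot φ A * C.codeProj) ∧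
      Complex.normSq w = Complex.normSq (amp Φ R) + Complex.normSq (amp Φ Rᶜ) := by
  obtain ⟨ε, hε, hLA⟩ := (represents_iff A).1 hL
  obtain ⟨φ, w, h1, h2⟩ := exists_rot_of_odd hA (h.odd_card_add_card_compl R) (realAmp Φ R)
    (realAmp Φ Rᶜ * ε)
  refine ⟨φ, w, ?_, ?_⟩
  · rw [smul_one_add_smul_mul_codeProj hLA, ← smul_mul_assoc, ← h1, amp_eq, amp_eq,
      Complex.ofReal_mul, mul_assoc]
  · rw [h2, ← amp_eq, Complex.ofReal_mul, ← mul_assoc, ← amp_eq, map_mul, Complex.normSq_ofReal, hε,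
      mul_one]

lemma exists_stepImplements_rot (h : C.IsBlockPartition L D) (hA : A * A = 1)
    (hL : C.Represents L A) {r : C.Syndrome → Finset (Fin M)} (hr : C.IsDecoder L D r)
    (Φ : Fin M → ℝ) :
    ∃ φ, StepImplements (blockStep C L D r Φ) (fun φ => rot φ A) φ :=
  h.exists_stepImplements hr Φ fun s _ => h.exists_rot hA hL Φ (r s)

/-- For the trivial syndrome the terms are `cosᴹ θ` and `(i sin θ)ᴹ L`, so every logical angle is
reached there. -/
lemma exists_angle_stepImplements_rot (h : C.IsBlockPartition L D) (hA : A * A = 1)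
    (hL : C.Represents L A) {r : C.Syndrome → Finset (Fin M)} (hr : C.IsDecoder L D r)
    (hr0 : r 0 = ∅) (φ : ℝ) :
    ∃ θ : ℝ, StepImplements (blockStep C L D r fun _ => θ) (fun φ => rot φ A) φ := by
  obtain ⟨ε, hε, hLA⟩ := (represents_iff A).1 hL
  obtain ⟨η, hη, hI⟩ : ∃ η : ℝ, η * η = 1 ∧ Complex.I ^ M = Complex.I * η := by
    have hM : (M : ZMod 2) = (1 : ℕ) := by
      rw [Nat.cast_one]; exact ZMod.natCast_eq_one_iff_odd.2 h.odd
    rcases I_pow_eq_or_of_cast_eq hM with h | h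
    · exact ⟨1, by norm_num, by rw [h]; simp⟩
    · exact ⟨-1, by norm_num, by rw [h]; simp⟩
  have hne : Real.cos φ ≠ 0 ∨ ε * η * Real.sin φ ≠ 0 := by
    by_contra hcon
    push Not at hcon
    have h1 : Real.sin φ = 0 := by
      linear_combination (ε * η) * hcon.2 - (η * η) * Real.sin φ * hε - Real.sin φ * hη
    have := Real.sin_sq_add_cos_sq φ
    rw [hcon.1, h1] at this
    norm_num at this
  obtain ⟨θ, c, hc, hcos, hsin⟩ := exists_angle_of_odd h.odd _ _ hne
  have ha : amp (fun _ : Fin M => θ) (r 0) = c * Real.cos φ := by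
    rw [hr0, amp_eq, realAmp]
    simp only [Finset.prod_const, Finset.compl_empty, Finset.card_empty, pow_zero, one_mul,
      Finset.card_univ, Fintype.card_fin]
    rw [hcos, Complex.ofReal_mul]
  have hb : amp (fun _ : Fin M => θ) (r 0)ᶜ = c * (Complex.I * Real.sin φ) * ε := by
    rw [hr0, amp_eq, realAmp]
    simp only [Finset.prod_const, Finset.compl_empty, Finset.compl_univ, Finset.card_empty,
      pow_zero, mul_one, Finset.card_univ, Fintype.card_fin]
    have hη' : (η : ℂ) * η = 1 := by exact_mod_cast hη
    rw [hsin, hI]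
    push_cast
    linear_combination (Complex.I * c * ε * Complex.sin φ) * hη'
  have hε' : (ε : ℂ) * ε = 1 := by exact_mod_cast hε
  refine ⟨θ, h.stepImplements hr _ (fun s _ => h.exists_rot hA hL _ (r s)) (s₀ := 0) (w₀ := c)
    ?_ ?_ ?_ (Complex.ofReal_ne_zero.2 hc)⟩
  · rw [hr0, Finset.biUnion_empty, restrict_empty, syndromeOf_zero]
  · rw [smul_one_add_smul_mul_codeProj hLA, ha, hb, mul_assoc _ (ε : ℂ), hε', mul_one, mul_smul,
      mul_smul, ← smul_add, ← rot_eq hA, smul_mul_assoc]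
  · rw [ha, hb]
    simp only [map_mul, Complex.normSq_ofReal, Complex.normSq_I]
    linear_combination (-(c * c)) * Real.sin_sq_add_cos_sq φ -
      (c * c * Real.sin φ * Real.sin φ) * hε

/-- At the angle `π/4` all terms have the same modulus, so each syndrome leaves a rotation by
`± π/4`; of two complementary corrections one gives the prescribed sign `τ`. -/
lemma exists_decoder_quarter (h : C.IsBlockPartition L D) (hL : C.Represents L A) {τ : ℝ}
    (hτ : τ * τ = 1) {g : ℂ} (hg : Complex.normSq g = 1 / 2) :
    ∃ r, C.IsDecoder L D r ∧ StepImplements (blockStep C L D r fun _ => Real.pi / 4)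
      (fun _ : Unit => g • (1 - (τ * Complex.I) • A)) () := by
  obtain ⟨ε, hε, hLA⟩ := (represents_iff A).1 hL
  have hε' : (ε : ℂ) * ε = 1 := by exact_mod_cast hε
  have hg0 : g ≠ 0 := fun h0 => by rw [h0, map_zero] at hg; norm_num at hg
  obtain ⟨r, hr, hQ⟩ := h.exists_decoder
    (fun R => Complex.I ^ Rᶜ.card * ε = -(τ * Complex.I) * Complex.I ^ R.card) fun R => by
    have hc : ((Rᶜ.card : ℕ) : ZMod 2) = ((R.card + 1 : ℕ) : ZMod 2) := by
      rw [ZMod.natCast_eq_natCast_iff']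
      have := Nat.odd_iff.1 (h.odd_card_add_card_compl R)
      omega
    rw [compl_compl]
    rcases I_pow_eq_or_of_cast_eq hc with hI | hI <;> rw [hI, pow_succ] <;>
    rcases mul_self_eq_one_iff.1 hε with rfl | rfl <;>
    rcases mul_self_eq_one_iff.1 hτ with rfl | rfl <;>
    first
    | (left; push_cast; ring1)
    | (right; push_cast; linear_combination (Complex.I ^ R.card) * Complex.I_sq)
    | (right; push_cast; linear_combination (-Complex.I ^ R.card) * Complex.I_sq)
  have hreal : ∀ R : Finset (Fin M), realAmp (fun _ => Real.pi / 4) R = (√2 / 2) ^ M := by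
    intro R
    rw [realAmp, Real.sin_pi_div_four, Real.cos_pi_div_four, Finset.prod_mul_prod_compl,
      Finset.prod_const, Finset.card_univ, Fintype.card_fin]
  have hb : ∀ s, amp (fun _ => Real.pi / 4) (r s)ᶜ * ε =
      -(τ * Complex.I) * amp (fun _ => Real.pi / 4) (r s) := by
    intro s
    rw [amp_eq, amp_eq, hreal, hreal, mul_right_comm, hQ s, mul_assoc]
  have hn : ∀ s, Complex.normSq (amp (fun _ => Real.pi / 4) (r s)ᶜ) =
      Complex.normSq (amp (fun _ => Real.pi / 4) (r s)) := by
    intro s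
    rw [amp_eq, amp_eq, hreal, hreal]
    simp
  refine ⟨r, hr, (h.exists_stepImplements hr _ fun s _ =>
    ⟨(), amp (fun _ => Real.pi / 4) (r s) / g, ?_, ?_⟩).elim fun _ hx => hx⟩
  · rw [smul_one_add_smul_mul_codeProj hLA, hb, smul_mul_assoc, smul_smul, div_mul_cancel₀ _ hg0,
      ← smul_mul_assoc]
    congr 1
    module
  · rw [map_div₀, hg, hn]; ring

end IsBlockPartition

lemma isLogicalUnitary_rot (hA : A * A = 1) (hAH : Aᴴ = A) (hc : Commute A C.codeProj) (φ : ℝ) :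
    C.IsLogicalUnitary (rot φ A) := by
  refine ⟨Matrix.mem_unitaryGroup_iff.2 ?_, ?_⟩
  · have hs : ((Real.sin φ : ℂ)) ^ 2 + (Real.cos φ : ℂ) ^ 2 = 1 := by
      exact_mod_cast Real.sin_sq_add_cos_sq φ
    rw [Matrix.star_eq_conjTranspose, rot_eq hA, Matrix.conjTranspose_add,
      Matrix.conjTranspose_smul, Matrix.conjTranspose_smul, Matrix.conjTranspose_one, hAH,
      star_mul', Complex.star_def, Complex.conj_ofReal, Complex.conj_ofReal, Complex.conj_I,
      add_mul, mul_add, mul_add]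
    simp only [smul_mul_smul_comm, one_mul, mul_one, hA]
    rw [← sub_eq_zero]
    trans ((Real.sin φ : ℂ) ^ 2 + (Real.cos φ : ℂ) ^ 2 - 1) • (1 : Op n) -
      ((Complex.I ^ 2 + 1) * (Real.sin φ : ℂ) ^ 2) • (1 : Op n)
    · module
    · rw [hs, Complex.I_sq]; simp
  · rw [rot_eq hA]
    exact ((Commute.one_left _).smul_left _).add_left (hc.smul_left _)

/-! ### Logical Pauli operators and logical phase gates -/

section

variable {n : ℕ} {C : CSSCode n}

lemma commute_xOp_codeProj {a : Fin n → ZMod 2} (h : C.HZ *ᵥ a = 0) :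
    Commute (xOp a) C.codeProj := by
  have := C.commute_pauliOp_codeProj (p := (a, 0))
    (Prod.ext (Matrix.mulVec_zero C.HX) h)
  simpa [pauliOp] using this

lemma commute_zOp_codeProj {b : Fin n → ZMod 2} (h : C.HX *ᵥ b = 0) :
    Commute (zOp b) C.codeProj := by
  have := C.commute_pauliOp_codeProj (p := (0, b))
    (Prod.ext h (Matrix.mulVec_zero C.HZ))
  simpa [pauliOp] using this

/-- Multiplying a Pauli string by a stabilizer does not change its action on the code space. -/
lemma pauliOp_add_stabilizer_mul_codeProj {p q : PauliString n} (hp : C.HX *ᵥ p.2 = 0)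
    (hq : C.IsStabilizer q) :
    pauliOp (p + q) * C.codeProj = Complex.I ^ (Finset.univ.filter fun j =>
      (p + q).1 j ≠ 0 ∧ (p + q).2 j ≠ 0).card • (xOp p.1 * zOp p.2 * C.codeProj) := by
  have h0 : p.2 ⬝ᵥ q.1 = 0 := (dotProduct_comm _ _).trans (dotProduct_eq_zero_of_mem_span hq.1 hp)
  rw [pauliOp, smul_mul_assoc, Prod.fst_add, Prod.snd_add, ← xOp_mul_xOp, ← zOp_mul_zOp,
    mul_assoc (xOp p.1), ← mul_assoc (xOp q.1), commute_zOp_xOp h0 |>.eq.symm]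
  simp only [mul_assoc]
  rw [C.zOp_mul_codeProj_of_mem_span hq.2, C.xOp_mul_codeProj_of_mem_span hq.1]

end

namespace LogicalBasis

variable {n k : ℕ} {C : CSSCode n} (B : C.LogicalBasis k)

/-- The Pauli string of the logical Pauli operator `(μ, ν)`. -/
def pauliString (μ ν : Fin k → ZMod 2) : PauliString n := (∑ i, μ i • B.α i, ∑ i, ν i • B.β i)

lemma syndromeOf_pauliString (μ ν : Fin k → ZMod 2) : C.syndromeOf (B.pauliString μ ν) = 0 := by
  refine Prod.ext ?_ ?_
  · simp [syndromeOf, pauliString, Matrix.mulVec_sum, Matrix.mulVec_smul, B.β_logical]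
  · simp [syndromeOf, pauliString, Matrix.mulVec_sum, Matrix.mulVec_smul, B.α_logical]

lemma sum_smul_dotProduct (μ : Fin k → ZMod 2) (i : Fin k) :
    (∑ i, μ i • B.α i) ⬝ᵥ B.β i = μ i := by
  rw [sum_dotProduct]
  simp [smul_dotProduct, B.pairing]

lemma dotProduct_pauliString (μ ν : Fin k → ZMod 2) :
    (∑ i, μ i • B.α i) ⬝ᵥ (∑ i, ν i • B.β i) =
      ((Finset.univ.filter fun i => μ i ≠ 0 ∧ ν i ≠ 0).card : ZMod 2) := by
  rw [dotProduct_sum, ← dotProduct_eq_card, dotProduct]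
  refine Finset.sum_congr rfl fun i _ => ?_
  rw [dotProduct_smul, sum_smul_dotProduct, smul_eq_mul, mul_comm]

lemma logicalPauli_mul_self (μ ν : Fin k → ZMod 2) :
    B.logicalPauli μ ν * B.logicalPauli μ ν = 1 :=
  I_pow_smul_mul_self (B.dotProduct_pauliString μ ν)

lemma conjTranspose_logicalPauli (μ ν : Fin k → ZMod 2) :
    (B.logicalPauli μ ν)ᴴ = B.logicalPauli μ ν :=
  hermitian_I_pow_smul (B.dotProduct_pauliString μ ν)

lemma commute_logicalPauli_codeProj (μ ν : Fin k → ZMod 2) :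
    Commute (B.logicalPauli μ ν) C.codeProj :=
  ((commute_xOp_codeProj (congrArg Prod.snd (B.syndromeOf_pauliString μ ν))).mul_left
    (commute_zOp_codeProj (congrArg Prod.fst (B.syndromeOf_pauliString μ ν)))).smul_left _

lemma isLogicalUnitary_rot_logicalPauli (μ ν : Fin k → ZMod 2) (φ : ℝ) :
    C.IsLogicalUnitary (rot φ (B.logicalPauli μ ν)) :=
  isLogicalUnitary_rot (B.logicalPauli_mul_self μ ν) (B.conjTranspose_logicalPauli μ ν)
    (B.commute_logicalPauli_codeProj μ ν) φ

lemma represents_of_isStabilizer_add {L : PauliString n} {μ ν : Fin k → ZMod 2}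
    (h : C.IsStabilizer (L + B.pauliString μ ν)) : C.Represents L (B.logicalPauli μ ν) := by
  set p := B.pauliString μ ν with hp
  have hL : L = p + (L + p) := by
    rw [add_left_comm, show p + p = 0 from Prod.ext (bits_add_self _) (bits_add_self _), add_zero]
  have hp2 : C.HX *ᵥ p.2 = 0 := congrArg Prod.fst (B.syndromeOf_pauliString μ ν)
  have hp1 : C.HZ *ᵥ p.1 = 0 := congrArg Prod.snd (B.syndromeOf_pauliString μ ν)
  have hpar : ((Finset.univ.filter fun j => L.1 j ≠ 0 ∧ L.2 j ≠ 0).card : ZMod 2) =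
      ((Finset.univ.filter fun i => μ i ≠ 0 ∧ ν i ≠ 0).card : ZMod 2) := by
    rw [← dotProduct_eq_card, ← dotProduct_pauliString, hL, Prod.fst_add, Prod.snd_add,
      add_dotProduct, dotProduct_add, dotProduct_comm p.1 (L + p).2,
      dotProduct_eq_zero_of_mem_span h.2 hp1, add_zero,
      dotProduct_eq_zero_of_mem_span h.1
        (by rw [Matrix.mulVec_add, hp2, C.mulVec_eq_zero_of_mem_span_Z h.2, add_zero]), add_zero]
    rfl
  have hact := pauliOp_add_stabilizer_mul_codeProj hp2 h
  rw [← hL] at hact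
  rw [Represents, hact, logicalPauli, smul_mul_assoc]
  rcases I_pow_eq_or_of_cast_eq hpar with hI | hI <;> rw [hI]
  · exact Or.inl rfl
  · exact Or.inr (neg_smul _ _)

lemma exists_pivoted_partition (μ ν : Fin k → ZMod 2) :
    ∃ (L : PauliString n) (M : ℕ) (D : Fin M → Finset (Fin n)),
      C.Represents L (B.logicalPauli μ ν) ∧ C.IsBlockPartition L D ∧
      C.IsPivoted L fun m => restrict L (D m) := by
  obtain ⟨L, hL, hred⟩ := C.exists_isReduced (B.pauliString μ ν)
  have hsyn : C.syndromeOf L = 0 := by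
    have := hL.syndromeOf
    rwa [syndromeOf_add, syndromeOf_pauliString, add_zero] at this
  obtain ⟨M, D, hD, hpiv⟩ := hred.exists_partition hsyn
  exact ⟨L, M, D, B.represents_of_isStabilizer_add hL, hD, hpiv⟩

lemma logicalZ_eq (i : Fin k) : B.logicalZ i = zOp (B.β i) := by
  simp [logicalZ, logicalPauli, Pi.single_apply]

lemma logicalS_eq (i : Fin k) : B.logicalS i =
    ((1 + Complex.I) / 2) • (1 - (((1 : ℝ) : ℂ) * Complex.I) • B.logicalZ i) := by
  rw [logicalS, Complex.ofReal_one, one_mul, smul_sub ((1 + Complex.I) / 2), smul_smul,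
    show (1 + Complex.I) / 2 * Complex.I = (Complex.I - 1) / 2 by
      linear_combination (1 / 2) * Complex.I_sq]
  module

lemma conjTranspose_logicalS_eq (i : Fin k) : (B.logicalS i)ᴴ =
    ((1 - Complex.I) / 2) • (1 - (((-1 : ℝ) : ℂ) * Complex.I) • B.logicalZ i) := by
  rw [logicalS_eq, Matrix.conjTranspose_smul, Matrix.conjTranspose_sub, Matrix.conjTranspose_smul,
    Matrix.conjTranspose_one, logicalZ_eq, conjTranspose_zOp]
  congr 1
  · simp [sub_eq_add_neg]
  · simp

lemma commute_logicalS_conjTranspose (i j : Fin k) :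
    Commute (B.logicalS i)ᴴ (B.logicalS j)ᴴ := by
  rw [conjTranspose_logicalS_eq, conjTranspose_logicalS_eq, logicalZ_eq, logicalZ_eq]
  have hz : Commute (zOp (B.β i)) (zOp (B.β j)) := by
    rw [Commute, SemiconjBy, zOp_mul_zOp, zOp_mul_zOp, add_comm]
  exact (((Commute.one_left _).sub_left (((Commute.one_right _).sub_right
    (hz.smul_right _)).smul_left _)).smul_left _).smul_right _

/-- Conjugation with the phase gate turns a logical `X` into a logical `Y`. -/
lemma logicalS_conj {a : Fin n → ZMod 2} {i : Fin k} (h : a ⬝ᵥ B.β i = 1) (b : Fin n → ZMod 2) :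
    B.logicalS i * (xOp a * zOp b) * (B.logicalS i)ᴴ =
      Complex.I • (xOp a * zOp (b + B.β i)) := by
  have hz : zOp (B.β i) * (xOp a * zOp b) = -(xOp a * zOp (b + B.β i)) := by
    rw [← mul_assoc, zOp_mul_xOp, dotProduct_comm, h, sgn_one, neg_one_smul, neg_mul, mul_assoc,
      zOp_mul_zOp, add_comm]
  have hz' : ∀ c, xOp a * zOp c * zOp (B.β i) = xOp a * zOp (c + B.β i) := fun c => by
    rw [mul_assoc, zOp_mul_zOp]
  have hbb : b + B.β i + B.β i = b := by rw [add_assoc, bits_add_self, add_zero]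
  rw [conjTranspose_logicalS_eq, logicalS_eq, logicalZ_eq, smul_mul_assoc, sub_mul,
    smul_mul_assoc, smul_mul_assoc, hz, one_mul, mul_smul_comm, smul_smul, mul_sub, mul_one,
    sub_mul, mul_smul_comm, mul_smul_comm, smul_mul_assoc, neg_mul, hz', hz', hbb]
  generalize xOp a * zOp b = U
  generalize xOp a * zOp (b + B.β i) = V
  trans ((1 - Complex.I ^ 2) / 4 * (1 + Complex.I ^ 2)) • U +
    ((1 - Complex.I ^ 2) / 2 * Complex.I) • V
  · push_cast; module
  · rw [Complex.I_sq]; module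

lemma logicalS_mul_conjTranspose (i : Fin k) : B.logicalS i * (B.logicalS i)ᴴ = 1 := by
  rw [conjTranspose_logicalS_eq, logicalS_eq, logicalZ_eq, smul_mul_smul_comm, sub_mul, mul_sub,
    mul_sub, smul_mul_smul_comm, zOp_mul_self]
  simp only [one_mul, mul_one]
  generalize zOp (B.β i) = U
  trans ((1 - Complex.I ^ 2) * (1 - Complex.I ^ 2) / 4) • (1 : Op n)
  · push_cast; module
  · rw [Complex.I_sq]; norm_num

lemma isLogicalUnitary_logicalS (i : Fin k) : C.IsLogicalUnitary (B.logicalS i) := by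
  refine ⟨Matrix.mem_unitaryGroup_iff.2 (B.logicalS_mul_conjTranspose i), ?_⟩
  rw [logicalS_eq, logicalZ_eq]
  exact ((Commute.one_left _).sub_left
    ((commute_zOp_codeProj (B.β_logical i)).smul_left _)).smul_left _

lemma isLogicalUnitary_conjTranspose_logicalS (i : Fin k) :
    C.IsLogicalUnitary (B.logicalS i)ᴴ := by
  refine ⟨Unitary.star_mem (B.isLogicalUnitary_logicalS i).1, ?_⟩
  rw [conjTranspose_logicalS_eq, logicalZ_eq]
  exact ((Commute.one_left _).sub_left
    ((commute_zOp_codeProj (B.β_logical i)).smul_left _)).smul_left _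

lemma commute_conjTranspose_logicalS_prod (i : Fin k) (l : List (Fin k)) :
    Commute (B.logicalS i)ᴴ (l.map fun i => (B.logicalS i)ᴴ).reverse.prod := by
  refine Commute.list_prod_right _ _ fun x hx => ?_
  obtain ⟨j, -, rfl⟩ := List.mem_map.1 (List.mem_reverse.1 hx)
  exact B.commute_logicalS_conjTranspose i j

lemma prod_logicalS_conj {a : Fin n → ZMod 2} (l : List (Fin k))
    (h : ∀ i ∈ l, a ⬝ᵥ B.β i = 1) (b : Fin n → ZMod 2) :
    (l.map B.logicalS).reverse.prod * (xOp a * zOp b) *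
        (l.map fun i => (B.logicalS i)ᴴ).reverse.prod =
      Complex.I ^ l.length • (xOp a * zOp (b + (l.map B.β).sum)) := by
  induction l generalizing b with
  | nil => simp
  | cons i l ih =>
    have hcomm := (B.commute_conjTranspose_logicalS_prod i l).eq
    simp only [List.map_cons, List.reverse_cons, List.prod_append, List.prod_singleton,
      List.sum_cons, List.length_cons]
    rw [← hcomm]
    calc _ = (l.map B.logicalS).reverse.prod *
          (B.logicalS i * (xOp a * zOp b) * (B.logicalS i)ᴴ) *
          (l.map fun i => (B.logicalS i)ᴴ).reverse.prod := by simp only [mul_assoc]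
      _ = _ := by
        rw [B.logicalS_conj (h i List.mem_cons_self), mul_smul_comm, smul_mul_assoc,
          ih fun j hj => h j (List.mem_cons_of_mem _ hj), smul_smul, pow_succ', add_assoc]

lemma prod_logicalS_mul_prod (l : List (Fin k)) :
    (l.map B.logicalS).reverse.prod * (l.map fun i => (B.logicalS i)ᴴ).reverse.prod = 1 := by
  induction l with
  | nil => simp
  | cons i l ih =>
    simp only [List.map_cons, List.reverse_cons, List.prod_append, List.prod_singleton]
    rw [← (B.commute_conjTranspose_logicalS_prod i l).eq, mul_assoc, ← mul_assoc (B.logicalS i),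
      logicalS_mul_conjTranspose, one_mul, ih]

lemma ySites_nodup (μ ν : Fin k → ZMod 2) : (ySites μ ν).Nodup :=
  (List.nodup_finRange k).filter _

lemma ySites_toFinset (μ ν : Fin k → ZMod 2) :
    (ySites μ ν).toFinset = Finset.univ.filter fun i => μ i ≠ 0 ∧ ν i ≠ 0 := by
  ext i; simp [ySites]

/-- The phase gates on the `Y` sites turn the logical Pauli operator without `Y` factors into
`logicalPauli μ ν`. -/
lemma prod_logicalS_conj_logicalPauli (μ ν : Fin k → ZMod 2) :
    ((ySites μ ν).map B.logicalS).reverse.prod * B.logicalPauli μ (ν - μ * ν) *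
        ((ySites μ ν).map fun i => (B.logicalS i)ᴴ).reverse.prod = B.logicalPauli μ ν := by
  have hempty : (Finset.univ.filter fun i => μ i ≠ 0 ∧ (ν - μ * ν) i ≠ 0) = ∅ := by
    refine Finset.filter_eq_empty_iff.2 fun i _ => ?_
    rw [Pi.sub_apply, Pi.mul_apply]
    generalize μ i = s; generalize ν i = t
    revert s t; decide
  have hone : ∀ i ∈ ySites μ ν, (∑ i, μ i • B.α i) ⬝ᵥ B.β i = 1 := by
    intro i hi
    have hi' : μ i ≠ 0 := by
      have := (Finset.mem_filter.1 ((ySites_toFinset μ ν) ▸ List.mem_toFinset.2 hi)).2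
      exact this.1
    rw [sum_smul_dotProduct]
    revert hi'; generalize μ i = s; revert s; decide
  have hsum : (∑ i, (ν - μ * ν) i • B.β i) + ((ySites μ ν).map B.β).sum = ∑ i, ν i • B.β i := by
    rw [← List.sum_toFinset _ (ySites_nodup μ ν), ySites_toFinset, Finset.sum_filter,
      ← Finset.sum_add_distrib]
    refine Finset.sum_congr rfl fun i _ => ?_
    rw [Pi.sub_apply, Pi.mul_apply]
    have hs : ∀ s : ZMod 2, s = 0 ∨ s = 1 := by decide
    rcases hs (μ i) with h1 | h1 <;> rcases hs (ν i) with h2 | h2 <;> simp [h1, h2]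
  rw [logicalPauli, hempty, Finset.card_empty, pow_zero, one_smul, B.prod_logicalS_conj _ hone,
    hsum, logicalPauli, ← ySites_toFinset, List.toFinset_card_of_nodup (ySites_nodup μ ν)]

lemma prod_logicalS_conj_rot (μ ν : Fin k → ZMod 2) (φ : ℝ) :
    ((ySites μ ν).map B.logicalS).reverse.prod * rot φ (B.logicalPauli μ (ν - μ * ν)) *
        ((ySites μ ν).map fun i => (B.logicalS i)ᴴ).reverse.prod =
      rot φ (B.logicalPauli μ ν) := by
  rw [rot_eq (B.logicalPauli_mul_self _ _), rot_eq (B.logicalPauli_mul_self _ _), mul_add, add_mul,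
    mul_smul_comm, mul_smul_comm, smul_mul_assoc, smul_mul_assoc, mul_one, prod_logicalS_mul_prod,
    prod_logicalS_conj_logicalPauli]

/-- The rotation about `logicalPauli μ ν` out of a step for the rotation without `Y` factors. -/
lemma implements_conj_logicalS {sS sSdg : Fin k → C.Step}
    (hS : ∀ i, StepImplements (sS i) (fun _ : Unit => B.logicalS i) ())
    (hSdg : ∀ i, StepImplements (sSdg i) (fun _ : Unit => (B.logicalS i)ᴴ) ())
    (μ ν : Fin k → ZMod 2) {st : C.Step} {φ : ℝ}
    (hst : StepImplements st (fun φ => rot φ (B.logicalPauli μ (ν - μ * ν))) φ) :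
    Implements ((ySites μ ν).map sSdg ++ [st] ++ (ySites μ ν).map sS)
      (fun φ => rot φ (B.logicalPauli μ ν)) φ := by
  have hpost : Implements ((ySites μ ν).map sS)
      (fun _ : Unit => ((ySites μ ν).map B.logicalS).reverse.prod) () := by
    have := (implements_nil (C := C) (fun _ : Unit => 1) (x := ()) rfl).map_append hS
      (fun i => (B.isLogicalUnitary_logicalS i).2) (ySites μ ν)
    simpa using this
  have hmid := hpost.cons hst fun φ => (B.isLogicalUnitary_rot_logicalPauli _ _ φ).2
  have hall := hmid.map_append hSdg
    (fun i => (B.isLogicalUnitary_conjTranspose_logicalS i).2) (ySites μ ν)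
  rw [List.append_assoc]
  exact hall.reindex Prod.fst (fun p => B.prod_logicalS_conj_rot μ ν p.1) rfl

end LogicalBasis

lemma Implements.isWeakTransversal {n : ℕ} {C : CSSCode n} {c : C.Circuit} {A : Op n} {N : ℕ}
    {φ : ℝ} (h : Implements c (fun φ => rot φ A) φ)
    (hA : ∀ φ, C.IsLogicalUnitary (rot φ A)) (hlen : c.length ≤ N)
    (hlayer : ∀ st ∈ c, st.IsLayer) : C.IsWeakTransversal A N c := by
  obtain ⟨p, f, hp, -⟩ := h.realizes hA
  exact ⟨hlen, hlayer, p, f, hp⟩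

end CSSCode

end WeakTransversal

theorem theorem2 {n k d : ℕ} (C : CSSCode n) (hC : C.HasParameters k d)
    (B : C.LogicalBasis k) (μ ν : Fin k → ZMod 2) (hP : μ ≠ 0 ∨ ν ≠ 0)
    (hQ : bodyCount μ ν ≤ d) :
    -- one layer of rotations on a pivoted disjoint support partition of the logical Pauli
    (∃ (L : PauliString n) (M : ℕ) (P : Fin M → PauliString n)
        (corr : C.Syndrome → PauliString n),
      C.Represents L (B.logicalPauli μ ν) ∧
      C.IsDisjointSupportPartition L P ∧ C.IsPivoted L P ∧
      (∀ Φ : Fin M → ℝ, C.IsWeakTransversal (B.logicalPauli μ ν) 1 [⟨M, P, Φ, corr⟩]) ∧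
      C.IsWeakTransversalRotation (B.logicalPauli μ ν) 1
        (fun θ => [⟨M, P, fun _ => θ, corr⟩])) ∧
    -- the same gate from the Pauli without Y factors, by conjugation with S and S† gates
    (∃ (L : PauliString n) (M : ℕ) (P : Fin M → PauliString n)
        (corr : C.Syndrome → PauliString n)
        (LS : Fin k → PauliString n) (MS : Fin k → ℕ)
        (PS : (i : Fin k) → Fin (MS i) → PauliString n)
        (corrS corrSdg : Fin k → C.Syndrome → PauliString n),
      C.Represents L (B.logicalPauli μ (ν - μ * ν)) ∧
      C.IsDisjointSupportPartition L P ∧ C.IsPivoted L P ∧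
      (∀ i, C.Represents (LS i) (B.logicalZ i) ∧
        C.IsDisjointSupportPartition (LS i) (PS i) ∧ C.IsPivoted (LS i) (PS i) ∧
        (∃ p, C.Realizes [⟨MS i, PS i, fun _ => Real.pi / 4, corrS i⟩] p
          (fun _ => B.logicalS i)) ∧
        (∃ p, C.Realizes [⟨MS i, PS i, fun _ => Real.pi / 4, corrSdg i⟩] p
          (fun _ => (B.logicalS i)ᴴ))) ∧
      C.IsWeakTransversalRotation (B.logicalPauli μ ν) (2 * (ySites μ ν).length + 1)
        (fun θ =>
          (ySites μ ν).map (fun i => ⟨MS i, PS i, fun _ => Real.pi / 4, corrSdg i⟩) ++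
          [⟨M, P, fun _ => θ, corr⟩] ++
          (ySites μ ν).map (fun i => ⟨MS i, PS i, fun _ => Real.pi / 4, corrS i⟩))) := by
  constructor
  · obtain ⟨L, M, D, hrep, hD, hpiv⟩ := B.exists_pivoted_partition μ ν
    obtain ⟨r, hr, hr0⟩ := hD.exists_decoder_zero
    have hA := B.logicalPauli_mul_self μ ν
    have hU := B.isLogicalUnitary_rot_logicalPauli μ ν
    have hΦ : ∀ Φ : Fin M → ℝ, C.IsWeakTransversal (B.logicalPauli μ ν) 1
        [C.blockStep L D r Φ] := by
      intro Φ
      obtain ⟨φ, hφ⟩ := hD.exists_stepImplements_rot hA hrep hr Φ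
      refine (hφ.implements fun φ => (hU φ).2).isWeakTransversal hU le_rfl fun st hst => ?_
      rw [List.mem_singleton.1 hst]
      exact hD.isDisjointSupportPartition.1
    refine ⟨L, M, fun m => restrict L (D m), fun s => restrict L ((r s).biUnion D), hrep,
      hD.isDisjointSupportPartition, hpiv, hΦ, fun θ => hΦ _, fun φ => ?_⟩
    obtain ⟨θ, hθ⟩ := hD.exists_angle_stepImplements_rot hA hrep hr hr0 φ
    exact ⟨θ, (hθ.implements fun φ => (hU φ).2).realizes hU⟩
  · obtain ⟨L, M, D, hrep, hD, hpiv⟩ := B.exists_pivoted_partition μ (ν - μ * ν)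
    obtain ⟨r, hr, hr0⟩ := hD.exists_decoder_zero
    have hA := B.logicalPauli_mul_self μ (ν - μ * ν)
    have hU := B.isLogicalUnitary_rot_logicalPauli μ ν
    choose LS MS DS hrepS hDS hpivS using fun i : Fin k =>
      B.exists_pivoted_partition 0 (Pi.single i 1)
    choose rS hrS hS using fun i => (hDS i).exists_decoder_quarter (hrepS i) (τ := 1)
      (g := (1 + Complex.I) / 2) (by norm_num) (by norm_num [Complex.normSq_apply])
    choose rSdg hrSdg hSdg using fun i => (hDS i).exists_decoder_quarter (hrepS i) (τ := -1)
      (g := (1 - Complex.I) / 2) (by norm_num) (by norm_num [Complex.normSq_apply])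
    have hS' : ∀ i, CSSCode.StepImplements (C.blockStep (LS i) (DS i) (rS i) fun _ => Real.pi / 4)
        (fun _ : Unit => B.logicalS i) () := fun i => by
      rw [B.logicalS_eq]; exact hS i
    have hSdg' : ∀ i, CSSCode.StepImplements
        (C.blockStep (LS i) (DS i) (rSdg i) fun _ => Real.pi / 4)
        (fun _ : Unit => (B.logicalS i)ᴴ) () := fun i => by
      rw [B.conjTranspose_logicalS_eq]; exact hSdg i
    refine ⟨L, M, fun m => restrict L (D m), fun s => restrict L ((r s).biUnion D), LS, MS,
      fun i m => restrict (LS i) (DS i m), fun i s => restrict (LS i) ((rS i s).biUnion (DS i)),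
      fun i s => restrict (LS i) ((rSdg i s).biUnion (DS i)), hrep,
      hD.isDisjointSupportPartition, hpiv, fun i => ⟨hrepS i, (hDS i).isDisjointSupportPartition,
        hpivS i, ?_, ?_⟩, fun θ => ?_, fun φ => ?_⟩
    · obtain ⟨p, f, hp, -⟩ := ((hS' i).implements fun _ =>
        (B.isLogicalUnitary_logicalS i).2).realizes fun _ => B.isLogicalUnitary_logicalS i
      exact ⟨p, hp⟩
    · obtain ⟨p, f, hp, -⟩ := ((hSdg' i).implements fun _ =>
        (B.isLogicalUnitary_conjTranspose_logicalS i).2).realizes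
          fun _ => B.isLogicalUnitary_conjTranspose_logicalS i
      exact ⟨p, hp⟩
    · obtain ⟨φ, hφ⟩ := hD.exists_stepImplements_rot hA hrep hr fun _ => θ
      refine (B.implements_conj_logicalS hS' hSdg' μ ν hφ).isWeakTransversal hU ?_ fun st hst => ?_
      · simp only [List.length_append, List.length_map, List.length_singleton]
        omega
      · rcases List.mem_append.1 hst with hst | hst
        · rcases List.mem_append.1 hst with hst | hst
          · obtain ⟨i, -, rfl⟩ := List.mem_map.1 hst
            exact (hDS i).isDisjointSupportPartition.1
          · rw [List.mem_singleton.1 hst]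
            exact hD.isDisjointSupportPartition.1
        · obtain ⟨i, -, rfl⟩ := List.mem_map.1 hst
          exact (hDS i).isDisjointSupportPartition.1
    · obtain ⟨θ, hθ⟩ := hD.exists_angle_stepImplements_rot hA hrep hr hr0 φ
      exact ⟨θ, (B.implements_conj_logicalS hS' hSdg' μ ν hθ).realizes hU⟩
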